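/- Let $k$ be an arbitrary field and $V$ a $k$-vector space. Two subspaces $A,B\subseteq V$ are commensurable, $A\sim B$, if $(A+B)/(A\cap B)$ is finite dimensional. For a subspace $A\subseteq V$ let $$\mathrm{GL}(V,A)=\{f\in \mathrm{Aut}_k(V) : f(A)\sim A\},$$ and for $f\in \mathrm{GL}(V,A)$ let $i(f,A,V)=\dim_k A/(A\cap fA)-\dim_k fA/(A\cap fA)\in\mathbb Z$. For $A\sim B$ let $(A|B)$ be the one-dimensional space $\Lambda^{\max}(A/A\cap B)\otimes_k\Lambda^{\max}(B/A\cap B)^*$; for every $N\subseteq A\cap B$ of finite codimension in $A$ and in $B$ it is canonically $\mathrm{Hom}_k(\Lambda^{\max}(B/N),\Lambda^{\max}(A/N))$, and composition of such maps gives contractions $(A|B)\otimes(B|C)\to(A|C)$. The determinantal central extension of Arbarello, De Concini and Kac, $$1\to k^\times\to\widetilde{\mathrm{GL}(V,A)}\xrightarrow{\ \pi\ }\mathrm{GL}(V,A)\to 1,$$ is the group of pairs $(f,s)$ with $f\in\mathrm{GL}(V,A)$ and $0\neq s\in (A|fA)$, with product $(f,s)(g,t)=(fg,\,s\cdot f(t))$,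 where $f(t)\in(fA|fgA)$. For commuting $\sigma,\tau\in\mathrm{GL}(V,A)$ let $\{\sigma,\tau\}^V_A=\tilde\sigma\tilde\tau\tilde\sigma^{-1}\tilde\tau^{-1}\in k^\times$, where $\tilde\sigma,\tilde\tau$ are any lifts of $\sigma,\tau$ to $\widetilde{\mathrm{GL}(V,A)}$. Let $\{V_i\}_{i\in I}$ be a reciprocity-admissible family of subspaces of $V$, i.e. $\sum_{i\in I}V_i\sim V$ and $V_i\cap\sum_{j\ne i}V_j\sim\{0\}$ for every $i\in I$. Let $\mathrm{GL}(V,\{V_i\}_{i\in I})$ be the group of those $\sigma\in\mathrm{Aut}_k(V)$ with $\sigma\in\mathrm{GL}(V,V_i)$ for all $i$ and $\sigma(V_i)=V_i$ for all but finitely many $i$. Then for all commuting $\sigma,\tau\in\mathrm{GL}(V,\{V_i\}_{i\in I})$, only finitely many of the factors $(-1)^{i(\sigma,V_i,V)\,i(\tau,V_i,V)}\{\sigma,\tau\}^V_{V_i}$ are different from $1$, and $$\prod_{i\in I}(-1)^{i(\sigma,V_i,V)\,i(\tau,V_i,V)}\,\{\sigma,\tau\}^V_{V_i}=1 .$$ 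-/

import Mathlib

namespace ACK

section Commensurability

variable {k V : Type*} [Field k] [AddCommGroup V] [Module k V]

/-- `A` and `B` are commensurable: `(A + B) / (A ∩ B)` is finite dimensional. -/
def Commensurable (A B : Submodule k V) : Prop :=
  Module.Finite k (↥(A ⊔ B) ⧸ (A ⊓ B).submoduleOf (A ⊔ B))

/-- Auxiliary: `A` is contained in `N` up to a finite-dimensional space. -/
def AlmostLE (A N : Submodule k V) : Prop :=
  ∃ F : Submodule k V, F.FG ∧ A ≤ N ⊔ F

theorem AlmostLE.of_le {A N : Submodule k V} (h : A ≤ N) : AlmostLE A N :=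
  ⟨⊥, Submodule.fg_bot, by simpa using h⟩

theorem AlmostLE.trans {A N M : Submodule k V} (h : AlmostLE A N) (h' : AlmostLE N M) :
    AlmostLE A M := by
  obtain ⟨F, hF, h1⟩ := h
  obtain ⟨G, hG, h2⟩ := h'
  refine ⟨G ⊔ F, hG.sup hF, h1.trans ?_⟩
  rw [← sup_assoc]
  exact sup_le_sup_right h2 F

theorem AlmostLE.sup {A B N : Submodule k V} (h : AlmostLE A N) (h' : AlmostLE B N) :
    AlmostLE (A ⊔ B) N := by
  obtain ⟨F, hF, h1⟩ := h
  obtain ⟨G, hG, h2⟩ := h'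
  refine ⟨F ⊔ G, hF.sup hG, sup_le (h1.trans ?_) (h2.trans ?_)⟩
  · exact sup_le_sup_left le_sup_left N
  · exact sup_le_sup_left le_sup_right N

theorem AlmostLE.map {A N : Submodule k V} (h : AlmostLE A N) (f : V →ₗ[k] V) :
    AlmostLE (A.map f) (N.map f) := by
  obtain ⟨F, hF, h1⟩ := h
  refine ⟨F.map f, hF.map f, ?_⟩
  rw [← Submodule.map_sup]
  exact Submodule.map_mono h1

theorem almostLE_iff_fg {A N : Submodule k V} : AlmostLE A N ↔ (A.map N.mkQ).FG := by
  constructor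
  · rintro ⟨F, hF, h⟩
    have h1 : A.map N.mkQ ≤ F.map N.mkQ := by
      refine (Submodule.map_mono h).trans ?_
      rw [Submodule.map_sup]
      simp
    have : Module.Finite k ↥(F.map N.mkQ) := Module.Finite.iff_fg.2 (hF.map _)
    exact Module.Finite.iff_fg.1 (Submodule.finiteDimensional_of_le h1)
  · intro h
    obtain ⟨S, hS⟩ := h
    have hmem : ∀ x ∈ S, ∃ v : V, N.mkQ v = x := fun x _ => N.mkQ_surjective x
    choose! g hg using hmem
    classical
    refine ⟨Submodule.span k (S.image g), Submodule.fg_span (Finset.finite_toSet _), ?_⟩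
    have h2 : (Submodule.span k (S.image g : Set V)).map N.mkQ = A.map N.mkQ := by
      rw [Submodule.map_span, ← hS]
      congr 1
      ext x
      simp only [Finset.coe_image, Set.mem_image, Finset.mem_coe]
      constructor
      · rintro ⟨_, ⟨y, hy, rfl⟩, rfl⟩
        rw [hg y hy]; exact hy
      · intro hx
        exact ⟨g x, ⟨x, hx, rfl⟩, hg x hx⟩
    intro v hv
    have : v ∈ (A.map N.mkQ).comap N.mkQ := Submodule.mem_comap.2 (Submodule.mem_map_of_mem hv)
    rw [← h2, Submodule.comap_map_mkQ] at this
    exact this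

/-- Finitely many vectors of `A` suffice. -/
theorem AlmostLE.exists_le {A N : Submodule k V} (h : AlmostLE A N) :
    AlmostLE A (N ⊓ A) := by
  rw [almostLE_iff_fg] at h
  have : Module.Finite k ↥(A.map N.mkQ) := Module.Finite.iff_fg.2 h
  obtain ⟨S, hS⟩ := h
  have hmem : ∀ x ∈ S, ∃ v ∈ A, N.mkQ v = x := by
    intro x hx
    have : x ∈ A.map N.mkQ := by rw [← hS]; exact Submodule.subset_span hx
    simpa using this
  choose! g hgA hg using hmem
  classical
  refine ⟨Submodule.span k (S.image g), Submodule.fg_span (Finset.finite_toSet _), ?_⟩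
  have hle : Submodule.span k (S.image g : Set V) ≤ A := by
    rw [Submodule.span_le]
    intro x hx
    simp only [Finset.coe_image, Set.mem_image, Finset.mem_coe] at hx
    obtain ⟨y, hy, rfl⟩ := hx
    exact hgA y hy
  have h2 : (Submodule.span k (S.image g : Set V)).map N.mkQ = A.map N.mkQ := by
    rw [Submodule.map_span, ← hS]
    congr 1
    ext x
    simp only [Finset.coe_image, Set.mem_image, Finset.mem_coe]
    constructor
    · rintro ⟨_, ⟨y, hy, rfl⟩, rfl⟩
      rw [hg y hy]; exact hy
    · intro hx
      exact ⟨g x, ⟨x, hx, rfl⟩, hg x hx⟩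
  intro v hv
  have h3 : v ∈ (A.map N.mkQ).comap N.mkQ := Submodule.mem_comap.2 (Submodule.mem_map_of_mem hv)
  rw [← h2, Submodule.comap_map_mkQ] at h3
  obtain ⟨n, hn, s, hs, rfl⟩ := Submodule.mem_sup.1 h3
  refine Submodule.add_mem_sup ⟨hn, ?_⟩ hs
  have := A.sub_mem hv (hle hs)
  simpa using this

theorem AlmostLE.inf {A N M : Submodule k V} (h : AlmostLE A N) (h' : AlmostLE A M) :
    AlmostLE A (N ⊓ M) := by
  have h1 := h.exists_le
  have h2 : AlmostLE (N ⊓ A) M := (AlmostLE.of_le inf_le_right).trans h'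
  refine (h1.trans h2.exists_le).trans (AlmostLE.of_le ?_)
  exact le_inf (inf_le_right.trans inf_le_left) inf_le_left

theorem commensurable_iff {A B : Submodule k V} :
    Commensurable A B ↔ AlmostLE A B ∧ AlmostLE B A := by
  have key : Commensurable A B ↔ AlmostLE (A ⊔ B) (A ⊓ B) := by
    rw [almostLE_iff_fg, ← Module.Finite.iff_fg]
    have e : (↥(A ⊔ B) ⧸ (A ⊓ B).submoduleOf (A ⊔ B)) ≃ₗ[k] ↥((A ⊔ B).map (A ⊓ B).mkQ) := by
      refine LinearEquiv.trans (Submodule.quotEquivOfEq _ _ ?_)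
        (((A ⊓ B).mkQ.domRestrict (A ⊔ B)).quotKerEquivRange.trans (LinearEquiv.ofEq _ _ ?_))
      · ext x
        simp [Submodule.submoduleOf]
      · rw [LinearMap.range_domRestrict]
    exact Module.Finite.equiv_iff e
  rw [key]
  constructor
  · intro h
    exact ⟨((AlmostLE.of_le le_sup_left).trans h).trans (AlmostLE.of_le inf_le_right),
      ((AlmostLE.of_le le_sup_right).trans h).trans (AlmostLE.of_le inf_le_left)⟩
  · rintro ⟨h1, h2⟩
    exact AlmostLE.sup (AlmostLE.inf (AlmostLE.of_le le_rfl) h1)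
      (AlmostLE.inf h2 (AlmostLE.of_le le_rfl))

theorem Commensurable.refl (A : Submodule k V) : Commensurable A A :=
  commensurable_iff.2 ⟨AlmostLE.of_le le_rfl, AlmostLE.of_le le_rfl⟩

theorem Commensurable.symm {A B : Submodule k V} (h : Commensurable A B) : Commensurable B A :=
  commensurable_iff.2 (commensurable_iff.1 h).symm

theorem Commensurable.trans {A B C : Submodule k V} (h : Commensurable A B)
    (h' : Commensurable B C) : Commensurable A C := by
  rw [commensurable_iff] at *
  exact ⟨h.1.trans h'.1, h'.2.trans h.2⟩

theorem Commensurable.map {A B : Submodule k V} (h : Commensurable A B) (f : V →ₗ[k] V) :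
    Commensurable (A.map f) (B.map f) := by
  rw [commensurable_iff] at *
  exact ⟨h.1.map f, h.2.map f⟩

theorem subspace_map_mul (A : Submodule k V) (f g : V ≃ₗ[k] V) :
    A.map ((f * g : V ≃ₗ[k] V) : V →ₗ[k] V) = (A.map (g : V →ₗ[k] V)).map (f : V →ₗ[k] V) :=
  Submodule.map_comp (g : V →ₗ[k] V) (f : V →ₗ[k] V) A

theorem subspace_map_one (A : Submodule k V) : A.map ((1 : V ≃ₗ[k] V) : V →ₗ[k] V) = A :=
  Submodule.map_id A

theorem map_inv_map (A : Submodule k V) (f : V ≃ₗ[k] V) :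
    (A.map (f : V →ₗ[k] V)).map ((f⁻¹ : V ≃ₗ[k] V) : V →ₗ[k] V) = A := by
  rw [← subspace_map_mul, inv_mul_cancel, subspace_map_one]

/-- `GL(V, A)`: the automorphisms `f` of `V` such that `f(A)` is commensurable with `A`. -/
def glRel (A : Submodule k V) : Subgroup (V ≃ₗ[k] V) where
  carrier := {f | Commensurable (A.map (f : V →ₗ[k] V)) A}
  mul_mem' := by
    intro f g hf hg
    simp only [Set.mem_ofPred_eq, subspace_map_mul] at *
    exact (hg.map _).trans hf
  one_mem' := by
    simp only [Set.mem_ofPred_eq, subspace_map_one]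
    exact Commensurable.refl A
  inv_mem' := by
    intro f hf
    simp only [Set.mem_ofPred_eq] at *
    have := hf.map ((f⁻¹ : V ≃ₗ[k] V) : V →ₗ[k] V)
    rw [map_inv_map] at this
    exact this.symm

end Commensurability

section Frames

variable {k V : Type*} [Field k] [AddCommGroup V] [Module k V]

/-- `N ⊆ A` and the classes of the listed vectors form an (ordered) basis of `A / N`. -/
def IsRelBasis (N A : Submodule k V) (a : List V) : Prop :=
  LinearIndependent k (fun i : Fin a.length => N.mkQ (a.get i)) ∧
    N ⊔ Submodule.span k {v | v ∈ a} = A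

/-- The exterior product `a₁ ∧ ⋯ ∧ aₙ` in the exterior algebra of `V / N`. -/
noncomputable def wedge (N : Submodule k V) (a : List V) : ExteriorAlgebra k (V ⧸ N) :=
  (a.map fun v => ExteriorAlgebra.ι k (N.mkQ v)).prod

theorem IsRelBasis.le {N A : Submodule k V} {a : List V} (h : IsRelBasis N A a) : N ≤ A :=
  h.2 ▸ le_sup_left

theorem IsRelBasis.mem {N A : Submodule k V} {a : List V} (h : IsRelBasis N A a) {v : V}
    (hv : v ∈ a) : v ∈ A :=
  h.2 ▸ (le_sup_right : _ ≤ N ⊔ _) (Submodule.subset_span hv)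

theorem IsRelBasis.nil (N : Submodule k V) : IsRelBasis N N [] :=
  ⟨by
    have : IsEmpty (Fin ([] : List V).length) := Fin.isEmpty'
    exact linearIndependent_empty_type, by simp⟩

theorem range_get (a : List V) (N : Submodule k V) :
    Set.range (fun i : Fin a.length => N.mkQ (a.get i)) = N.mkQ '' {v | v ∈ a} := by
  ext x
  simp only [Set.mem_range, Set.mem_image, Set.mem_ofPred_eq, List.mem_iff_get]
  constructor
  · rintro ⟨i, rfl⟩
    exact ⟨_, ⟨i, rfl⟩, rfl⟩
  · rintro ⟨_, ⟨i, rfl⟩, rfl⟩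
    exact ⟨i, rfl⟩

theorem IsRelBasis.span_range {N A : Submodule k V} {a : List V} (h : IsRelBasis N A a) :
    Submodule.span k (Set.range (fun i : Fin a.length => N.mkQ (a.get i))) = A.map N.mkQ := by
  rw [range_get, ← Submodule.map_span, ← h.2, Submodule.map_sup]
  simp

theorem IsRelBasis.almostLE {N A : Submodule k V} {a : List V} (h : IsRelBasis N A a) :
    AlmostLE A N :=
  ⟨_, Submodule.fg_span (List.finite_toSet a), h.2.ge⟩

theorem AlmostLE.exists_relBasis {N A : Submodule k V} (h : AlmostLE A N) (hle : N ≤ A) :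
    ∃ a, IsRelBasis N A a := by
  rw [almostLE_iff_fg] at h
  have : Module.Finite k ↥(A.map N.mkQ) := Module.Finite.iff_fg.2 h
  let b := Module.finBasis k ↥(A.map N.mkQ)
  have hmem : ∀ i, ∃ v ∈ A, N.mkQ v = b i := fun i => Submodule.mem_map.1 (b i).2
  choose g hgA hg using hmem
  refine ⟨List.ofFn g, ?_, ?_⟩
  · have h1 : LinearIndependent k (fun i => (b i : V ⧸ N)) :=
      b.linearIndependent.map' (A.map N.mkQ).subtype (Submodule.ker_subtype _)
    have h2 := h1.comp (Fin.cast (List.length_ofFn (f := g))) (Fin.cast_injective _)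
    convert h2 using 1
    ext i
    simp only [List.get_ofFn, hg]
    rfl
  · apply le_antisymm
    · refine sup_le hle (Submodule.span_le.2 ?_)
      intro v hv
      simp only [List.mem_ofFn', Set.mem_ofPred_eq, Set.mem_range] at hv
      obtain ⟨i, rfl⟩ := hv
      exact hgA i
    · have h3 : (Submodule.span k {v | v ∈ List.ofFn g}).map N.mkQ = A.map N.mkQ := by
        rw [Submodule.map_span]
        have : N.mkQ '' {v | v ∈ List.ofFn g} = (A.map N.mkQ).subtype '' Set.range b := by
          ext x
          simp only [List.mem_ofFn', Set.mem_image, Set.mem_range, Set.mem_ofPred_eq,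
            exists_exists_eq_and, hg, Submodule.subtype_apply]
        rw [this, ← Submodule.map_span, b.span_eq]
        simp
      intro v hv
      have : v ∈ (A.map N.mkQ).comap N.mkQ :=
        Submodule.mem_comap.2 (Submodule.mem_map_of_mem hv)
      rw [← h3, Submodule.comap_map_mkQ] at this
      exact this

theorem wedge_append (N : Submodule k V) (a b : List V) :
    wedge N (a ++ b) = wedge N a * wedge N b := by
  simp [wedge]

theorem wedge_cons (N : Submodule k V) (v : V) (b : List V) :
    wedge N (v :: b) = ExteriorAlgebra.ι k (N.mkQ v) * wedge N b := by
  simp [wedge]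

theorem wedge_eq (N : Submodule k V) (a : List V) :
    wedge N a = ExteriorAlgebra.ιMulti k a.length (fun i => N.mkQ (a.get i)) := by
  rw [ExteriorAlgebra.ιMulti_apply, wedge]
  congr 1
  conv_lhs => rw [← List.ofFn_get a]
  rw [List.map_ofFn]
  rfl

theorem IsRelBasis.wedge_ne_zero {N A : Submodule k V} {a : List V} (h : IsRelBasis N A a) :
    wedge N a ≠ 0 := by
  rw [wedge_eq]
  have h1 := exteriorPower.ιMulti_family_linearIndependent_field (n := a.length) h.1
  have h2 := h1.ne_zero (Set.powersetCard.ofFinEmbEquiv (RelEmbedding.refl _))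
  intro h3
  apply h2
  apply Subtype.ext
  rw [exteriorPower.ιMulti_family, Equiv.symm_apply_apply]
  exact h3

theorem IsRelBasis.length_eq {N A : Submodule k V} {a a' : List V} (h : IsRelBasis N A a)
    (h' : IsRelBasis N A a') : a.length = a'.length := by
  have h1 := finrank_span_eq_card h.1
  have h2 := finrank_span_eq_card h'.1
  rw [h.span_range, Fintype.card_fin] at h1
  rw [h'.span_range, Fintype.card_fin] at h2
  exact h1.symm.trans h2

theorem exists_smul_of_span {W : Type*} [AddCommGroup W] [Module k W] {n : ℕ} (v w : Fin n → W)
    (hv : LinearIndependent k v) (hw : ∀ i, w i ∈ Submodule.span k (Set.range v)) :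
    ∃ α : k, ExteriorAlgebra.ιMulti k n w = α • ExteriorAlgebra.ιMulti k n v := by
  let e := Module.Basis.span hv
  let f := (ExteriorAlgebra.ιMulti k (M := W) n).compLinearMap
    (Submodule.span k (Set.range v)).subtype
  have hf : f = (LinearMap.toSpanSingleton k _ (f e)).compAlternatingMap e.det := by
    apply Module.Basis.ext_alternating e
    intro σ hσ
    obtain ⟨π, rfl⟩ : ∃ π : Equiv.Perm (Fin n), ⇑π = σ :=
      ⟨Equiv.ofBijective σ (Finite.injective_iff_bijective.1 hσ), rfl⟩
    have h1 : f (fun i => e (π i)) = Equiv.Perm.sign π • f e := f.map_perm e π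
    have h2 : e.det (fun i => e (π i)) = Equiv.Perm.sign π • e.det e := e.det.map_perm e π
    rw [h1, LinearMap.compAlternatingMap_apply, h2, e.det_self]
    rcases Int.units_eq_one_or (Equiv.Perm.sign π) with h | h <;> simp [h]
  let w' : Fin n → Submodule.span k (Set.range v) := fun i => ⟨w i, hw i⟩
  refine ⟨e.det w', ?_⟩
  have h3 : f w' = ExteriorAlgebra.ιMulti k n w := rfl
  have h4 : f e = ExteriorAlgebra.ιMulti k n v := by
    simp only [f, AlternatingMap.compLinearMap_apply]
    congr 1
    ext i
    simp [e, Module.Basis.span_apply]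
  rw [← h3, ← h4]
  conv_lhs => rw [hf]
  simp

theorem IsRelBasis.exists_unit {N A : Submodule k V} {a a' : List V} (h : IsRelBasis N A a)
    (h' : IsRelBasis N A a') : ∃ α : kˣ, wedge N a' = α • wedge N a := by
  have hlen := h.length_eq h'
  have key : ∀ n (v : Fin n → V) (v' : Fin n → V), List.ofFn v = a → List.ofFn v' = a' →
      ∃ α : k, wedge N a' = α • wedge N a := by
    intro n v v' hv hv'
    have e1 : ∀ u : Fin n → V, wedge N (List.ofFn u) =
        ExteriorAlgebra.ιMulti k n (fun i => N.mkQ (u i)) := by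
      intro u
      rw [ExteriorAlgebra.ιMulti_apply, wedge, List.map_ofFn]
      rfl
    subst hv hv'
    rw [e1, e1]
    have hr : Set.range (fun i => N.mkQ (v i)) = N.mkQ '' {x | x ∈ List.ofFn v} := by
      ext x
      simp only [Set.mem_range, Set.mem_image, Set.mem_ofPred_eq, List.mem_ofFn',
        exists_exists_eq_and]
    apply exists_smul_of_span
    · have := h.1.comp (Fin.cast (List.length_ofFn (f := v)).symm) (Fin.cast_injective _)
      have e2 : ((fun i => N.mkQ ((List.ofFn v).get i)) ∘ Fin.cast (List.length_ofFn (f := v)).symm)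
          = fun i => N.mkQ (v i) := by
        ext i
        simp
      rwa [e2] at this
    · intro i
      rw [hr, ← range_get, h.span_range]
      exact Submodule.mem_map_of_mem (h'.mem (by simp [List.mem_ofFn']))
  obtain ⟨α, hα⟩ := key a.length a.get (fun i => a'.get (Fin.cast hlen i)) (List.ofFn_get a) (by
    apply List.ext_get
    · simp [hlen]
    · intro n h1 h2
      simp)
  have hα0 : α ≠ 0 := by
    rintro rfl
    rw [zero_smul] at hα
    exact h'.wedge_ne_zero hα
  exact ⟨Units.mk0 α hα0, hα⟩

theorem linearIndependent_append {V W : Type*} [AddCommGroup W] [Module k W] (q : V → W)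
    (c a : List V)
    (h : LinearIndependent k (Sum.elim (fun i : Fin c.length => q (c.get i))
      (fun i : Fin a.length => q (a.get i)))) :
    LinearIndependent k (fun i : Fin (c ++ a).length => q ((c ++ a).get i)) := by
  have h1 := h.comp (finSumFinEquiv.symm ∘ Fin.cast (List.length_append (as := c) (bs := a)))
    (finSumFinEquiv.symm.injective.comp (Fin.cast_injective _))
  convert h1 using 1
  ext i
  obtain ⟨j, rfl⟩ : ∃ j : Fin (c.length + a.length),
      Fin.cast (List.length_append (as := c) (bs := a)).symm j = i :=
    ⟨Fin.cast List.length_append i, by simp⟩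
  refine Fin.addCases (fun j => ?_) (fun j => ?_) j <;> simp

theorem IsRelBasis.append {M N A : Submodule k V} {c a : List V} (hc : IsRelBasis M N c)
    (ha : IsRelBasis N A a) : IsRelBasis M A (c ++ a) := by
  constructor
  · apply linearIndependent_append
    let q : (V ⧸ M) →ₗ[k] (V ⧸ N) := Submodule.mapQ M N LinearMap.id hc.le
    have hq : ∀ v, q (M.mkQ v) = N.mkQ v := fun v => rfl
    have ha1 : LinearIndependent k (q ∘ fun i : Fin a.length => M.mkQ (a.get i)) := ha.1
    refine LinearIndependent.sum_type hc.1 (ha1.of_comp q) ?_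
    rw [hc.span_range, Submodule.disjoint_def]
    intro x hx hxa
    obtain ⟨r, rfl⟩ := (Submodule.mem_span_range_iff_exists_fun k).1 hxa
    have h0 : q (∑ i, r i • M.mkQ (a.get i)) = 0 := by
      obtain ⟨n, hn, hn'⟩ := Submodule.mem_map.1 hx
      rw [← hn', hq]
      simpa using hn
    rw [map_sum] at h0
    simp only [map_smul] at h0
    have := Fintype.linearIndependent_iff.1 ha1 r h0
    simp [this]
  · have : {v | v ∈ c ++ a} = {v | v ∈ c} ∪ {v | v ∈ a} := by
      ext v; simp
    rw [this, Submodule.span_union, ← sup_assoc, hc.2, ha.2]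

theorem mul_wedge_congr {M : Submodule k V} (σ : V → V ⧸ M) (S : Submodule k (V ⧸ M))
    (hσ : ∀ v, M.mkQ v - σ v ∈ S) (a : List V) (y : ExteriorAlgebra k (V ⧸ M))
    (hy : ∀ n ∈ S, y * ExteriorAlgebra.ι k n = 0) :
    y * wedge M a = y * (a.map fun v => ExteriorAlgebra.ι k (σ v)).prod := by
  induction a generalizing y with
  | nil => simp [wedge]
  | cons v a ih =>
    rw [wedge_cons, List.map_cons, List.prod_cons, ← mul_assoc, ← mul_assoc]
    have h1 : y * ExteriorAlgebra.ι k (M.mkQ v) = y * ExteriorAlgebra.ι k (σ v) := by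
      have := hy _ (hσ v)
      rwa [map_sub, mul_sub, sub_eq_zero] at this
    rw [h1]
    apply ih
    intro n hn
    have h2 := eq_neg_of_add_eq_zero_left (ExteriorAlgebra.ι_add_mul_swap (R := k) (σ v) n)
    rw [mul_assoc, h2, mul_neg, ← mul_assoc, hy n hn, zero_mul, neg_zero]

theorem wedge_mul_mem {M : Submodule k V} {c : List V} {v : V} (hv : v ∈ c) :
    wedge M c * ExteriorAlgebra.ι k (M.mkQ v) = 0 := by
  induction c using List.reverseRecOn with
  | nil => simp at hv
  | append_singleton c u ih =>
    have h1 : wedge M [u] = ExteriorAlgebra.ι k (M.mkQ u) := by simp [wedge]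
    rw [wedge_append, h1, mul_assoc]
    rcases List.mem_append.1 hv with h | h
    · have h2 := eq_neg_of_add_eq_zero_left
        (ExteriorAlgebra.ι_add_mul_swap (R := k) (M.mkQ u) (M.mkQ v))
      rw [h2, mul_neg, ← mul_assoc, ih h, zero_mul, neg_zero]
    · rw [List.mem_singleton.1 h, ExteriorAlgebra.ι_sq_zero, mul_zero]

theorem wedge_mul_ι {M N : Submodule k V} {c : List V} (hc : IsRelBasis M N c) (n : V ⧸ M)
    (hn : n ∈ N.map M.mkQ) : wedge M c * ExteriorAlgebra.ι k n = 0 := by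
  rw [← hc.span_range, range_get] at hn
  refine Submodule.span_induction ?_ ?_ ?_ ?_ hn
  · rintro _ ⟨v, hv, rfl⟩
    exact wedge_mul_mem hv
  · simp
  · intro x y _ _ hx hy
    rw [map_add, mul_add, hx, hy, add_zero]
  · intro r x _ hx
    rw [map_smul, mul_smul_comm, hx, smul_zero]

theorem IsRelBasis.wedge_append_right {M N : Submodule k V} {c : List V} (hc : IsRelBasis M N c)
    {a a' : List V} {α : kˣ} (h : wedge N a' = α • wedge N a) :
    wedge M (c ++ a') = α • wedge M (c ++ a) := by
  let q : (V ⧸ M) →ₗ[k] (V ⧸ N) := Submodule.mapQ M N LinearMap.id hc.le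
  have hq : ∀ v, q (M.mkQ v) = N.mkQ v := fun v => rfl
  have hqs : LinearMap.range q = ⊤ := by
    rw [LinearMap.range_eq_top]
    intro x
    obtain ⟨v, rfl⟩ := N.mkQ_surjective x
    exact ⟨M.mkQ v, hq v⟩
  obtain ⟨σ, hσ⟩ := q.exists_rightInverse_of_surjective hqs
  have hσ' : ∀ v, M.mkQ v - σ (N.mkQ v) ∈ N.map M.mkQ := by
    intro v
    obtain ⟨u, hu⟩ := M.mkQ_surjective (M.mkQ v - σ (N.mkQ v))
    rw [← hu]
    refine Submodule.mem_map_of_mem ?_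
    have h1 : q (M.mkQ v - σ (N.mkQ v)) = 0 := by
      rw [map_sub, hq]
      have := LinearMap.congr_fun hσ (N.mkQ v)
      simp only [LinearMap.comp_apply, LinearMap.id_apply] at this
      rw [this, sub_self]
    rw [← hu, hq] at h1
    simpa using h1
  have key : ∀ b : List V, wedge M (c ++ b) =
      wedge M c * ExteriorAlgebra.map σ (wedge N b) := by
    intro b
    rw [wedge_append, mul_wedge_congr (fun v => σ (N.mkQ v)) _ hσ' b _ (wedge_mul_ι hc),
      wedge.eq_1 N b, map_list_prod, List.map_map]
    congr 3
    ext v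
    simp
  rw [key, key, h]
  simp [Units.smul_def]

theorem wedge_append_left {M : Submodule k V} {c c' : List V} {γ : kˣ}
    (h : wedge M c' = γ • wedge M c) (a : List V) :
    wedge M (c' ++ a) = γ • wedge M (c ++ a) := by
  rw [wedge_append, wedge_append, h, smul_mul_assoc]

end Frames
section DeterminantLines

variable {k V : Type*} [Field k] [AddCommGroup V] [Module k V]

/-- The nonzero elements of the determinant line
`(A | B) = Λ^max (A / A ∩ B) ⊗ (Λ^max (B / A ∩ B))^*` of two commensurable subspaces.

For every `N ⊆ A ∩ B` of finite codimension in `A` and in `B` this line is identified with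
`Hom (Λ^max (B / N), Λ^max (A / N))`, the identification for `N' ⊆ N` being given by
`c ∧ x ↦ c ∧ s x`, where `c` generates `Λ^max (N / N')`. A nonzero element is recorded through
its matrix coefficients: `s (b₁ ∧ ⋯ ∧ b_q) = coeff N a b • (a₁ ∧ ⋯ ∧ a_p)` for all bases `a` of
`A / N` and `b` of `B / N`. -/
structure DetElt (A B : Submodule k V) where
  coeff : ∀ (N : Submodule k V) (a b : List V), IsRelBasis N A a → IsRelBasis N B b → kˣ
  /-- Change of bases. -/
  wedge_law : ∀ (N : Submodule k V) (a a' b b' : List V) (ha : IsRelBasis N A a)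
    (ha' : IsRelBasis N A a') (hb : IsRelBasis N B b) (hb' : IsRelBasis N B b') (α β : kˣ),
    wedge N a' = α • wedge N a → wedge N b' = β • wedge N b →
      α * coeff N a' b' ha' hb' = β * coeff N a b ha hb
  /-- Change of the common subspace. -/
  stable : ∀ (N' N : Submodule k V) (c a b : List V) (hc : IsRelBasis N' N c)
    (ha : IsRelBasis N A a) (hb : IsRelBasis N B b),
    coeff N' (c ++ a) (c ++ b) (hc.append ha) (hc.append hb) = coeff N a b ha hb

namespace DetElt

variable {A B C D : Submodule k V}

theorem coeff_congr (s : DetElt A B) {N N' : Submodule k V} {a a' b b' : List V}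
    (hN : N = N') (haa : a = a') (hbb : b = b') (ha : IsRelBasis N A a) (hb : IsRelBasis N B b)
    (ha' : IsRelBasis N' A a') (hb' : IsRelBasis N' B b') :
    s.coeff N a b ha hb = s.coeff N' a' b' ha' hb' := by
  subst hN haa hbb
  rfl

@[ext]
theorem ext {s t : DetElt A B} (h : ∀ N a b ha hb, s.coeff N a b ha hb = t.coeff N a b ha hb) :
    s = t := by
  cases s
  cases t
  congr
  funext N a b ha hb
  exact h N a b ha hb

/-- Multiplication of an element of `(A | B)` by a nonzero scalar. -/
def smul (c : kˣ) (s : DetElt A B) : DetElt A B where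
  coeff N a b ha hb := c * s.coeff N a b ha hb
  wedge_law N a a' b b' ha ha' hb hb' α β h1 h2 := by
    rw [mul_left_comm, s.wedge_law N a a' b b' ha ha' hb hb' α β h1 h2, mul_left_comm]
  stable N' N c a b hc ha hb := by rw [s.stable N' N c a b hc ha hb]

/-- Transport along an equality `B = B'`. -/
def cast {B' : Submodule k V} (h : B' = B) (s : DetElt A B) : DetElt A B' where
  coeff N a b ha hb := s.coeff N a b ha (h ▸ hb)
  wedge_law N a a' b b' ha ha' hb hb' α β h1 h2 :=
    s.wedge_law N a a' b b' ha ha' (h ▸ hb) (h ▸ hb') α β h1 h2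
  stable N' N c a b hc ha hb := s.stable N' N c a b hc ha (h ▸ hb)

/-- Transport along an equality `A' = A`. -/
def castLeft {A' : Submodule k V} (h : A' = A) (s : DetElt A B) : DetElt A' B where
  coeff N a b ha hb := s.coeff N a b (h ▸ ha) hb
  wedge_law N a a' b b' ha ha' hb hb' α β h1 h2 :=
    s.wedge_law N a a' b b' (h ▸ ha) (h ▸ ha') hb hb' α β h1 h2
  stable N' N c a b hc ha hb := s.stable N' N c a b hc (h ▸ ha) hb

/-- The scalar `γ` with `w' = γ w`, for two generators of `Λ^max (A / N)`. -/
noncomputable def ratio {N A : Submodule k V} {a a' : List V} (ha : IsRelBasis N A a)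
    (ha' : IsRelBasis N A a') : kˣ :=
  (ha.exists_unit ha').choose

theorem ratio_spec {N A : Submodule k V} {a a' : List V} (ha : IsRelBasis N A a)
    (ha' : IsRelBasis N A a') : wedge N a' = ratio ha ha' • wedge N a :=
  (ha.exists_unit ha').choose_spec

theorem units_smul_inj {N A : Submodule k V} {a : List V} (ha : IsRelBasis N A a) {α β : kˣ}
    (h : α • wedge N a = β • wedge N a) : α = β := by
  apply Units.ext
  rw [Units.smul_def, Units.smul_def] at h
  exact smul_left_injective k ha.wedge_ne_zero h

theorem ratio_unique {N A : Submodule k V} {a a' : List V} (ha : IsRelBasis N A a)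
    (ha' : IsRelBasis N A a') {γ : kˣ} (h : wedge N a' = γ • wedge N a) : ratio ha ha' = γ :=
  units_smul_inj ha ((ratio_spec ha ha').symm.trans h)

/-- The identity, as an element of `(A | A)`. -/
noncomputable def one (A : Submodule k V) : DetElt A A where
  coeff _ _ _ ha hb := ratio ha hb
  wedge_law N a a' b b' ha ha' hb hb' α β h1 h2 := by
    apply units_smul_inj ha
    have h3 := ratio_spec ha' hb'
    rw [h2, h1, ratio_spec ha hb, smul_smul, smul_smul] at h3
    rw [h3, mul_comm]
  stable N' N c a b hc ha hb :=
    ratio_unique _ _ (hc.wedge_append_right (ratio_spec ha hb))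

/-- The inverse of a nonzero element, `(A | B) → (B | A)`. -/
def symm (s : DetElt A B) : DetElt B A where
  coeff N a b ha hb := (s.coeff N b a hb ha)⁻¹
  wedge_law N a a' b b' ha ha' hb hb' α β h1 h2 := by
    have := s.wedge_law N b b' a a' hb hb' ha ha' β α h2 h1
    rw [← div_eq_mul_inv, ← div_eq_mul_inv, div_eq_div_iff_mul_eq_mul, this]
  stable N' N c a b hc ha hb := by rw [s.stable N' N c b a hc hb ha]

theorem exists_common (hB : Commensurable B A) {N : Submodule k V} {a : List V}
    (ha : IsRelBasis N A a) : ∃ (M : Submodule k V) (c b : List V),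
      IsRelBasis M N c ∧ IsRelBasis M B b := by
  rw [commensurable_iff] at hB
  have h1 : AlmostLE B N := hB.1.trans ha.almostLE
  have h2 : AlmostLE N B := (AlmostLE.of_le ha.le).trans hB.2
  obtain ⟨c, hc⟩ := ((AlmostLE.of_le le_rfl).inf h2).exists_relBasis (N := N ⊓ B) inf_le_left
  obtain ⟨b, hb⟩ := (h1.inf (AlmostLE.of_le le_rfl)).exists_relBasis (N := N ⊓ B) inf_le_right
  exact ⟨_, c, b, hc, hb⟩

theorem comp_refine (s : DetElt A B) (t : DetElt B C) {N M L : Submodule k V}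
    {a d c b g : List V} (ha : IsRelBasis N A a) (hd : IsRelBasis N C d)
    (hc : IsRelBasis M N c) (hb : IsRelBasis M B b) (hg : IsRelBasis L M g) :
    s.coeff M (c ++ a) b (hc.append ha) hb * t.coeff M b (c ++ d) hb (hc.append hd) =
      s.coeff L ((g ++ c) ++ a) (g ++ b) ((hg.append hc).append ha) (hg.append hb) *
        t.coeff L (g ++ b) ((g ++ c) ++ d) (hg.append hb) ((hg.append hc).append hd) := by
  rw [← s.stable L M g (c ++ a) b hg, ← t.stable L M g b (c ++ d) hg]
  congr 1
  · exact s.coeff_congr rfl (List.append_assoc g c a).symm rfl _ _ _ _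
  · exact t.coeff_congr rfl rfl (List.append_assoc g c d).symm _ _ _ _

theorem comp_same (s : DetElt A B) (t : DetElt B C) {N M : Submodule k V}
    {a d c b c' b' : List V} (ha : IsRelBasis N A a) (hd : IsRelBasis N C d)
    (hc : IsRelBasis M N c) (hb : IsRelBasis M B b)
    (hc' : IsRelBasis M N c') (hb' : IsRelBasis M B b') :
    s.coeff M (c ++ a) b (hc.append ha) hb * t.coeff M b (c ++ d) hb (hc.append hd) =
      s.coeff M (c' ++ a) b' (hc'.append ha) hb' *
        t.coeff M b' (c' ++ d) hb' (hc'.append hd) := by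
  obtain ⟨γ, hγ⟩ := hc.exists_unit hc'
  obtain ⟨β, hβ⟩ := hb.exists_unit hb'
  have h1 := s.wedge_law M _ _ _ _ (hc.append ha) (hc'.append ha) hb hb' γ β
    (wedge_append_left hγ a) hβ
  have h2 := t.wedge_law M _ _ _ _ hb hb' (hc.append hd) (hc'.append hd) β γ
    hβ (wedge_append_left hγ d)
  have h3 : (γ * β) * (s.coeff M (c ++ a) b (hc.append ha) hb *
      t.coeff M b (c ++ d) hb (hc.append hd)) =
      (γ * β) * (s.coeff M (c' ++ a) b' (hc'.append ha) hb' *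
        t.coeff M b' (c' ++ d) hb' (hc'.append hd)) := by
    calc _ = (β * s.coeff M (c ++ a) b (hc.append ha) hb) *
          (γ * t.coeff M b (c ++ d) hb (hc.append hd)) := by
          rw [mul_comm γ β, mul_mul_mul_comm]
      _ = _ := by rw [← h1, ← h2, mul_mul_mul_comm]
  exact mul_left_cancel h3

theorem comp_indep (s : DetElt A B) (t : DetElt B C) {N M M' : Submodule k V}
    {a d c b c' b' : List V} (ha : IsRelBasis N A a) (hd : IsRelBasis N C d)
    (hc : IsRelBasis M N c) (hb : IsRelBasis M B b)
    (hc' : IsRelBasis M' N c') (hb' : IsRelBasis M' B b') :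
    s.coeff M (c ++ a) b (hc.append ha) hb * t.coeff M b (c ++ d) hb (hc.append hd) =
      s.coeff M' (c' ++ a) b' (hc'.append ha) hb' *
        t.coeff M' b' (c' ++ d) hb' (hc'.append hd) := by
  have h1 : AlmostLE M M' := (AlmostLE.of_le hc.le).trans hc'.almostLE
  have h2 : AlmostLE M' M := (AlmostLE.of_le hc'.le).trans hc.almostLE
  obtain ⟨g, hg⟩ := ((AlmostLE.of_le le_rfl).inf h1).exists_relBasis (N := M ⊓ M') inf_le_left
  obtain ⟨g', hg'⟩ := (h2.inf (AlmostLE.of_le le_rfl)).exists_relBasis (N := M ⊓ M') inf_le_right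
  rw [comp_refine s t ha hd hc hb hg, comp_refine s t ha hd hc' hb' hg']
  exact comp_same s t ha hd (hg.append hc) (hg.append hb) (hg'.append hc') (hg'.append hb')

theorem exists_comp (hB : Commensurable B A) (s : DetElt A B) (t : DetElt B C)
    {N : Submodule k V} {a d : List V} (ha : IsRelBasis N A a) (hd : IsRelBasis N C d) :
    ∃ x : kˣ, ∀ (M : Submodule k V) (c b : List V) (hc : IsRelBasis M N c)
      (hb : IsRelBasis M B b),
      x = s.coeff M (c ++ a) b (hc.append ha) hb * t.coeff M b (c ++ d) hb (hc.append hd) := by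
  obtain ⟨M, c, b, hc, hb⟩ := exists_common hB ha
  exact ⟨_, fun M' c' b' hc' hb' => comp_indep s t ha hd hc hb hc' hb'⟩

/-- The contraction `(A | B) ⊗ (B | C) → (A | C)`: composition of the maps
`Λ^max (C / M) → Λ^max (B / M) → Λ^max (A / M)` for a common subspace `M` of the three spaces
(see `DetElt.comp_coeff`; the coefficient is the common value for all choices of `M` and of the
bases). -/
noncomputable def comp (hB : Commensurable B A) (s : DetElt A B) (t : DetElt B C) :
    DetElt A C where
  coeff _ _ _ ha hd := (exists_comp hB s t ha hd).choose
  wedge_law N a a' d d' ha ha' hd hd' α δ h1 h2 := by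
    obtain ⟨M, c, b, hc, hb⟩ := exists_common hB ha
    rw [(exists_comp hB s t ha hd).choose_spec M c b hc hb,
      (exists_comp hB s t ha' hd').choose_spec M c b hc hb, ← mul_assoc,
      s.wedge_law M _ _ _ _ (hc.append ha) (hc.append ha') hb hb α 1
        (hc.wedge_append_right h1) (one_smul _ _).symm, one_mul]
    have h3 := t.wedge_law M _ _ _ _ hb hb (hc.append hd) (hc.append hd') 1 δ
        (one_smul _ _).symm (hc.wedge_append_right h2)
    rw [one_mul] at h3
    rw [h3, mul_left_comm]
  stable N' N e a d he ha hd := by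
    obtain ⟨M, c, b, hc, hb⟩ := exists_common hB (he.append ha)
    rw [(exists_comp hB s t (he.append ha) (he.append hd)).choose_spec M c b hc hb,
      (exists_comp hB s t ha hd).choose_spec M (c ++ e) b (hc.append he) hb]
    congr 1
    · exact s.coeff_congr rfl (List.append_assoc c e a).symm rfl _ _ _ _
    · exact t.coeff_congr rfl rfl (List.append_assoc c e d).symm _ _ _ _

/-- The contraction may be computed with any common subspace and any bases. -/
theorem comp_coeff (hB : Commensurable B A) (s : DetElt A B) (t : DetElt B C)
    {N M : Submodule k V} {a d c b : List V} (ha : IsRelBasis N A a) (hd : IsRelBasis N C d)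
    (hc : IsRelBasis M N c) (hb : IsRelBasis M B b) :
    (comp hB s t).coeff N a d ha hd =
      s.coeff M (c ++ a) b (hc.append ha) hb * t.coeff M b (c ++ d) hb (hc.append hd) :=
  (exists_comp hB s t ha hd).choose_spec M c b hc hb

end DetElt

theorem IsRelBasis.map {N A : Submodule k V} {a : List V} (h : IsRelBasis N A a)
    (f : V ≃ₗ[k] V) : IsRelBasis (N.map (f : V →ₗ[k] V)) (A.map (f : V →ₗ[k] V)) (a.map f) := by
  constructor
  · let e : (V ⧸ N) ≃ₗ[k] (V ⧸ N.map (f : V →ₗ[k] V)) :=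
      Submodule.Quotient.equiv N (N.map (f : V →ₗ[k] V)) f rfl
    have h1 := h.1.map' e.toLinearMap (LinearEquiv.ker e)
    have h2 := h1.comp (Fin.cast (List.length_map (as := a) f)) (Fin.cast_injective _)
    have h3 : (fun i : Fin (a.map f).length => (N.map (f : V →ₗ[k] V)).mkQ ((a.map f).get i)) =
        (e.toLinearMap ∘ fun i : Fin a.length => N.mkQ (a.get i)) ∘
          Fin.cast (List.length_map (as := a) f) := by
      ext i
      simp [e]
    rw [h3]
    exact h2
  · rw [← h.2, Submodule.map_sup, Submodule.map_span]
    congr 2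
    ext v
    simp

theorem wedge_map_smul {N : Submodule k V} {a a' : List V} {α : kˣ}
    (h : wedge N a' = α • wedge N a) (f : V ≃ₗ[k] V) :
    wedge (N.map (f : V →ₗ[k] V)) (a'.map f) =
      α • wedge (N.map (f : V →ₗ[k] V)) (a.map f) := by
  let q : (V ⧸ N) →ₗ[k] (V ⧸ N.map (f : V →ₗ[k] V)) :=
    Submodule.mapQ N _ (f : V →ₗ[k] V) (Submodule.le_comap_map _ _)
  have key : ∀ b : List V, wedge (N.map (f : V →ₗ[k] V)) (b.map f) =
      ExteriorAlgebra.map q (wedge N b) := by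
    intro b
    rw [wedge, wedge, map_list_prod, List.map_map, List.map_map]
    congr 2
    ext v
    simp [q]
  rw [key, key, h]
  simp [Units.smul_def]

theorem IsRelBasis.map_inv {N A : Submodule k V} {a : List V} {f : V ≃ₗ[k] V}
    (h : IsRelBasis N (A.map (f : V →ₗ[k] V)) a) :
    IsRelBasis (N.map ((f⁻¹ : V ≃ₗ[k] V) : V →ₗ[k] V)) A
      (a.map (f⁻¹ : V ≃ₗ[k] V)) := by
  have := h.map f⁻¹
  rwa [map_inv_map] at this

/-- The map `(A | B) → (f A | f B)` induced by an automorphism `f` of `V`. -/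
def DetElt.map {A B : Submodule k V} (f : V ≃ₗ[k] V) (s : DetElt A B) :
    DetElt (A.map (f : V →ₗ[k] V)) (B.map (f : V →ₗ[k] V)) where
  coeff N a b ha hb := s.coeff (N.map ((f⁻¹ : V ≃ₗ[k] V) : V →ₗ[k] V))
    (a.map (f⁻¹ : V ≃ₗ[k] V)) (b.map (f⁻¹ : V ≃ₗ[k] V)) ha.map_inv hb.map_inv
  wedge_law N a a' b b' ha ha' hb hb' α β h1 h2 :=
    s.wedge_law _ _ _ _ _ ha.map_inv ha'.map_inv hb.map_inv hb'.map_inv α β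
      (wedge_map_smul h1 f⁻¹) (wedge_map_smul h2 f⁻¹)
  stable N' N c a b hc ha hb := by
    rw [← s.stable _ _ _ _ _ (hc.map f⁻¹) ha.map_inv hb.map_inv]
    exact s.coeff_congr rfl List.map_append List.map_append _ _ _ _

end DeterminantLines
section Extension

variable {k V : Type*} [Field k] [AddCommGroup V] [Module k V]

/-- The determinantal central extension of `GL(V, A)`: the set of pairs `(f, s)` with
`f ∈ GL(V, A)` and `s` a nonzero element of the line `(A | f A)`. -/
structure DetExt (A : Submodule k V) where
  toGL : glRel A
  elt : DetElt A (A.map ((toGL : V ≃ₗ[k] V) : V →ₗ[k] V))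

namespace DetExt

variable {A : Submodule k V}

theorem ext_coeff {x y : DetExt A} (h : x.toGL = y.toGL)
    (h' : ∀ N a b (ha : IsRelBasis N A a)
      (hb : IsRelBasis N (A.map ((x.toGL : V ≃ₗ[k] V) : V →ₗ[k] V)) b)
      (hb' : IsRelBasis N (A.map ((y.toGL : V ≃ₗ[k] V) : V →ₗ[k] V)) b),
      x.elt.coeff N a b ha hb = y.elt.coeff N a b ha hb') : x = y := by
  obtain ⟨f, s⟩ := x
  obtain ⟨g, t⟩ := y
  dsimp at h
  subst h
  congr
  ext1 N a b ha hb
  exact h' N a b ha hb hb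

/-- `(f, s) (g, t) = (f g, s · f(t))`, where `f(t) ∈ (f A | f g A)`. -/
noncomputable instance : Mul (DetExt A) where
  mul x y := ⟨x.toGL * y.toGL,
    (x.elt.comp x.toGL.2 (y.elt.map (x.toGL : V ≃ₗ[k] V))).cast (subspace_map_mul A _ _)⟩

noncomputable instance : One (DetExt A) where
  one := ⟨1, (DetElt.one A).cast (subspace_map_one A)⟩

/-- `(f, s)⁻¹ = (f⁻¹, f⁻¹(s⁻¹))`. -/
noncomputable instance : Inv (DetExt A) where
  inv x := ⟨x.toGL⁻¹,
    (x.elt.symm.map ((x.toGL⁻¹ : glRel A) : V ≃ₗ[k] V)).castLeft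
      (map_inv_map A (x.toGL : V ≃ₗ[k] V)).symm⟩

theorem mul_toGL (x y : DetExt A) : (x * y).toGL = x.toGL * y.toGL := rfl

theorem one_toGL : (1 : DetExt A).toGL = 1 := rfl

theorem inv_toGL (x : DetExt A) : (x⁻¹).toGL = x.toGL⁻¹ := rfl

theorem isRelBasis_mul {f g : V ≃ₗ[k] V} {N : Submodule k V} {d : List V}
    (hd : IsRelBasis N (A.map ((f * g : V ≃ₗ[k] V) : V →ₗ[k] V)) d) :
    IsRelBasis N ((A.map (g : V →ₗ[k] V)).map (f : V →ₗ[k] V)) d :=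
  subspace_map_mul A f g ▸ hd

theorem mul_coeff (x y : DetExt A) {N M : Submodule k V} {a d c b : List V}
    (ha : IsRelBasis N A a)
    (hd : IsRelBasis N (A.map (((x * y).toGL : V ≃ₗ[k] V) : V →ₗ[k] V)) d)
    (hc : IsRelBasis M N c)
    (hb : IsRelBasis M (A.map ((x.toGL : V ≃ₗ[k] V) : V →ₗ[k] V)) b) :
    (x * y).elt.coeff N a d ha hd =
      x.elt.coeff M (c ++ a) b (hc.append ha) hb *
        (y.elt.map (x.toGL : V ≃ₗ[k] V)).coeff M b (c ++ d) hb
          (hc.append (isRelBasis_mul hd)) :=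
  DetElt.comp_coeff x.toGL.2 x.elt (y.elt.map (x.toGL : V ≃ₗ[k] V)) ha (isRelBasis_mul hd) hc hb

theorem exists_common_two {B C N : Submodule k V} {a : List V} (ha : IsRelBasis N A a)
    (hB : Commensurable B A) (hC : Commensurable C A) :
    ∃ (M : Submodule k V) (c b d : List V),
      IsRelBasis M N c ∧ IsRelBasis M B b ∧ IsRelBasis M C d := by
  obtain ⟨M, c, b, hc, hb⟩ := DetElt.exists_common hB ha
  obtain ⟨L, g, d, hg, hd⟩ := DetElt.exists_common hC (hc.append ha)
  exact ⟨L, g ++ c, g ++ b, d, hg.append hc, hg.append hb, hd⟩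

protected theorem mul_assoc (x y z : DetExt A) : x * y * z = x * (y * z) := by
  refine ext_coeff (mul_assoc _ _ _) ?_
  intro N a e ha he he'
  obtain ⟨M, c, b, d, hc, hb, hd⟩ := exists_common_two ha x.toGL.2 (x.toGL * y.toGL).2
  have hd' : IsRelBasis M (A.map (((x * y).toGL : V ≃ₗ[k] V) : V →ₗ[k] V)) d := hd
  have hce : IsRelBasis M _ (c ++ e) := hc.append (isRelBasis_mul (isRelBasis_mul he'))
  rw [mul_coeff (x * y) z ha he hc hd', mul_coeff x (y * z) ha he' hc hb,
    mul_coeff x y (hc.append ha) hd' (IsRelBasis.nil M) hb, mul_assoc]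
  congr 1
  have h1 := mul_coeff y z (N := M.map (((x.toGL : V ≃ₗ[k] V)⁻¹ : V ≃ₗ[k] V) : V →ₗ[k] V))
    (a := b.map ((x.toGL : V ≃ₗ[k] V)⁻¹ : V ≃ₗ[k] V))
    (d := (c ++ e).map ((x.toGL : V ≃ₗ[k] V)⁻¹ : V ≃ₗ[k] V))
    hb.map_inv (hc.append (isRelBasis_mul he')).map_inv (IsRelBasis.nil _)
    (isRelBasis_mul hd').map_inv
  refine Eq.trans ?_ h1.symm
  congr 1
  refine z.elt.coeff_congr ?_ ?_ ?_ _ _ _ _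
  · rw [← subspace_map_mul, mul_toGL, Subgroup.coe_mul, mul_inv_rev]
  · rw [List.map_map, mul_toGL, Subgroup.coe_mul, mul_inv_rev]
    rfl
  · rw [List.nil_append, List.map_map, mul_toGL, Subgroup.coe_mul, mul_inv_rev]
    rfl

theorem one_coeff {N : Submodule k V} {a b : List V} (ha : IsRelBasis N A a)
    (hb : IsRelBasis N A b)
    (hb' : IsRelBasis N (A.map (((1 : DetExt A).toGL : V ≃ₗ[k] V) : V →ₗ[k] V)) b) :
    (1 : DetExt A).elt.coeff N a b ha hb' = DetElt.ratio ha hb := rfl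

protected theorem one_mul (x : DetExt A) : 1 * x = x := by
  refine ext_coeff (one_mul _) ?_
  intro N a d ha hd hd'
  have ha' : IsRelBasis N (A.map (((1 : DetExt A).toGL : V ≃ₗ[k] V) : V →ₗ[k] V)) a := by
    rw [one_toGL, Subgroup.coe_one, subspace_map_one]; exact ha
  rw [mul_coeff 1 x ha hd (IsRelBasis.nil N) ha', one_coeff (a := [] ++ a) ha ha,
    DetElt.ratio_unique (a := [] ++ a) ha ha (one_smul _ _).symm, one_mul]
  refine x.elt.coeff_congr ?_ ?_ ?_ _ _ _ _
  · rw [one_toGL, Subgroup.coe_one, inv_one, subspace_map_one]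
  · rw [one_toGL, Subgroup.coe_one, inv_one]
    exact List.map_id a
  · rw [one_toGL, Subgroup.coe_one, inv_one]
    exact List.map_id d

protected theorem inv_mul_cancel (x : DetExt A) : x⁻¹ * x = 1 := by
  refine ext_coeff (inv_mul_cancel _) ?_
  intro N a d ha hd hd'
  have hdA : IsRelBasis N A d := by
    rw [one_toGL, Subgroup.coe_one, subspace_map_one] at hd'; exact hd'
  obtain ⟨M, c, b, hc, hb⟩ := DetElt.exists_common (x⁻¹).toGL.2 ha
  rw [mul_coeff x⁻¹ x ha hd hc hb, one_coeff ha hdA hd']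
  have key : ∀ (g : V ≃ₗ[k] V) (hg : g = (x.toGL : V ≃ₗ[k] V))
      (h1 : IsRelBasis (M.map (g : V →ₗ[k] V)) A (b.map g))
      (h2 : IsRelBasis (M.map (g : V →ₗ[k] V))
        (A.map ((x.toGL : V ≃ₗ[k] V) : V →ₗ[k] V)) ((c ++ a).map g))
      (h3 : IsRelBasis (M.map (g : V →ₗ[k] V))
        (A.map ((x.toGL : V ≃ₗ[k] V) : V →ₗ[k] V)) ((c ++ d).map g)),
      (x.elt.coeff _ _ _ h1 h2)⁻¹ * x.elt.coeff _ _ _ h1 h3 = DetElt.ratio ha hdA := by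
    intro g hg h1 h2 h3
    have h4 := x.elt.wedge_law _ _ _ _ _ h1 h1 h2 h3 1 (DetElt.ratio ha hdA) (one_smul _ _).symm
      (wedge_map_smul (hc.wedge_append_right (DetElt.ratio_spec ha hdA)) g)
    rw [one_mul] at h4
    rw [h4, mul_left_comm, inv_mul_cancel, mul_one]
  exact key (((x⁻¹).toGL : V ≃ₗ[k] V)⁻¹) (by rw [inv_toGL, Subgroup.coe_inv, inv_inv]) _ _ _

noncomputable instance : Group (DetExt A) :=
  Group.ofLeftAxioms DetExt.mul_assoc DetExt.one_mul DetExt.inv_mul_cancel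

/-- The projection `π` of the extension onto `GL(V, A)`. -/
noncomputable def proj (A : Submodule k V) : DetExt A →* glRel A where
  toFun := toGL
  map_one' := rfl
  map_mul' _ _ := rfl

/-- Multiplication of the line component by a scalar. -/
def scale (c : kˣ) (x : DetExt A) : DetExt A := ⟨x.toGL, x.elt.smul c⟩

theorem scale_mul (c : kˣ) (x y : DetExt A) : scale c x * y = scale c (x * y) := by
  refine ext_coeff rfl ?_
  intro N a d ha hd hd'
  obtain ⟨M, g, b, hg, hb⟩ := DetElt.exists_common x.toGL.2 ha
  rw [mul_coeff (scale c x) y ha hd hg hb]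
  have := mul_coeff x y ha hd hg hb
  change _ = c * (x * y).elt.coeff N a d ha hd
  rw [this, ← mul_assoc]
  rfl

theorem mul_scale (c : kˣ) (x y : DetExt A) : x * scale c y = scale c (x * y) := by
  refine ext_coeff rfl ?_
  intro N a d ha hd hd'
  obtain ⟨M, g, b, hg, hb⟩ := DetElt.exists_common x.toGL.2 ha
  rw [mul_coeff x (scale c y) ha hd hg hb]
  have := mul_coeff x y ha hd hg hb
  change _ = c * (x * y).elt.coeff N a d ha hd
  rw [this, mul_left_comm]
  rfl

theorem scale_scale (c d : kˣ) (x : DetExt A) : scale (c * d) x = scale c (scale d x) := by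
  refine ext_coeff rfl ?_
  intro N a b ha hb hb'
  exact mul_assoc _ _ _

theorem one_scale (x : DetExt A) : scale 1 x = x := by
  refine ext_coeff rfl ?_
  intro N a b ha hb hb'
  exact one_mul _

/-- The inclusion `c ↦ (1, c)` of the scalars into the extension. -/
noncomputable def incl (A : Submodule k V) : kˣ →* DetExt A where
  toFun c := scale c 1
  map_one' := one_scale 1
  map_mul' c d := by rw [scale_mul, one_mul, scale_scale]

theorem incl_apply (c : kˣ) : incl A c = scale c 1 := rfl

theorem incl_central (c : kˣ) (x : DetExt A) : incl A c * x = x * incl A c := by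
  rw [incl_apply, scale_mul, mul_scale, one_mul, mul_one]

theorem incl_injective (A : Submodule k V) : Function.Injective (incl A) := by
  intro c d h
  have hA : IsRelBasis A A [] := IsRelBasis.nil A
  have hA' : IsRelBasis A (A.map (((1 : DetExt A).toGL : V ≃ₗ[k] V) : V →ₗ[k] V)) [] := by
    rw [one_toGL, Subgroup.coe_one, subspace_map_one]; exact hA
  have h1 : ∀ e : kˣ, ∀ (x : DetExt A), x = incl A e →
      ∀ h' : IsRelBasis A (A.map ((x.toGL : V ≃ₗ[k] V) : V →ₗ[k] V)) [],
      x.elt.coeff A [] [] hA h' = e * (1 : DetExt A).elt.coeff A [] [] hA hA' := by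
    rintro e _ rfl h'
    rfl
  have h2 := h1 c _ rfl hA'
  rw [h1 d _ h hA'] at h2
  exact (mul_right_cancel h2).symm

/-- The kernel of `π` is the group of scalars. -/
theorem ker_proj (A : Submodule k V) : (proj A).ker = (incl A).range := by
  ext x
  constructor
  · intro hx
    have hx' : x.toGL = 1 := hx
    obtain ⟨f, s⟩ := x
    dsimp at hx'
    subst hx'
    have hA : IsRelBasis A A [] := IsRelBasis.nil A
    have hm : A.map (((1 : glRel A) : V ≃ₗ[k] V) : V →ₗ[k] V) = A := subspace_map_one A
    refine ⟨s.coeff A [] [] hA (hm.symm ▸ hA), ?_⟩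
    refine ext_coeff rfl ?_
    intro N a b ha hb hb'
    have hb2 : IsRelBasis N A b := hm ▸ hb'
    have ha2 : IsRelBasis N (A.map (((1 : glRel A) : V ≃ₗ[k] V) : V →ₗ[k] V)) a := hm.symm ▸ ha
    change _ * DetElt.ratio ha hb2 = s.coeff N a b ha hb'
    have h1 := s.stable N A a [] [] ha hA (hm.symm ▸ hA)
    have h2 : s.coeff N a a ha ha2 = s.coeff A [] [] hA (hm.symm ▸ hA) := by
      rw [← h1]
      exact s.coeff_congr rfl (List.append_nil a).symm (List.append_nil a).symm _ _ _ _
    have h3 := s.wedge_law N a a a b ha ha ha2 hb' 1 (DetElt.ratio ha hb2)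
      (one_smul _ _).symm (DetElt.ratio_spec ha hb2)
    rw [one_mul] at h3
    rw [h3, ← h2, mul_comm]
  · rintro ⟨c, rfl⟩
    rfl

end DetExt


end Extension
section Commutator

variable {k V : Type*} [Field k] [AddCommGroup V] [Module k V]

/-- The determinant line of two commensurable subspaces has a nonzero element. -/
theorem DetElt.nonempty {A B : Submodule k V} (h : Commensurable A B) : Nonempty (DetElt A B) := by
  rw [commensurable_iff] at h
  obtain ⟨a₀, ha₀⟩ := ((AlmostLE.of_le le_rfl).inf h.1).exists_relBasis (N := A ⊓ B) inf_le_left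
  obtain ⟨b₀, hb₀⟩ := (h.2.inf (AlmostLE.of_le le_rfl)).exists_relBasis (N := A ⊓ B) inf_le_right
  have hc : ∀ (N : Submodule k V) (a b : List V), IsRelBasis N A a → IsRelBasis N B b →
      ∃ c, IsRelBasis N (A ⊓ B) c := by
    intro N a b ha hb
    exact ((AlmostLE.of_le inf_le_left).trans ha.almostLE).exists_relBasis (le_inf ha.le hb.le)
  have key : ∀ (N : Submodule k V) (a b : List V) (ha : IsRelBasis N A a) (hb : IsRelBasis N B b),
      ∃ x : kˣ, ∀ (c : List V) (hc : IsRelBasis N (A ⊓ B) c),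
        x = DetElt.ratio (hc.append hb₀) hb * (DetElt.ratio (hc.append ha₀) ha)⁻¹ := by
    intro N a b ha hb
    obtain ⟨c, hc⟩ := hc N a b ha hb
    refine ⟨DetElt.ratio (hc.append hb₀) hb * (DetElt.ratio (hc.append ha₀) ha)⁻¹,
      fun c' hc' => ?_⟩
    obtain ⟨γ, hγ⟩ := hc.exists_unit hc'
    have h1 : DetElt.ratio (hc.append hb₀) hb = DetElt.ratio (hc'.append hb₀) hb * γ := by
      apply DetElt.ratio_unique
      rw [DetElt.ratio_spec (hc'.append hb₀) hb, wedge_append_left hγ, smul_smul]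
    have h2 : DetElt.ratio (hc.append ha₀) ha = DetElt.ratio (hc'.append ha₀) ha * γ := by
      apply DetElt.ratio_unique
      rw [DetElt.ratio_spec (hc'.append ha₀) ha, wedge_append_left hγ, smul_smul]
    rw [h1, h2, ← div_eq_mul_inv, ← div_eq_mul_inv, mul_div_mul_right_eq_div]
  choose x hx using key
  refine ⟨⟨x, ?_, ?_⟩⟩
  · intro N a a' b b' ha ha' hb hb' α β h1 h2
    obtain ⟨c, hc⟩ := hc N a b ha hb
    have h3 : DetElt.ratio (hc.append hb₀) hb' = β * DetElt.ratio (hc.append hb₀) hb := by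
      apply DetElt.ratio_unique
      rw [h2, DetElt.ratio_spec (hc.append hb₀) hb, smul_smul]
    have h4 : DetElt.ratio (hc.append ha₀) ha' = α * DetElt.ratio (hc.append ha₀) ha := by
      apply DetElt.ratio_unique
      rw [h1, DetElt.ratio_spec (hc.append ha₀) ha, smul_smul]
    rw [hx N a b ha hb c hc, hx N a' b' ha' hb' c hc, h3, h4, mul_inv, mul_left_comm, mul_inv_cancel_left,
      mul_assoc]
  · intro N' N e a b he ha hb
    obtain ⟨c, hc⟩ := hc N a b ha hb
    rw [hx N a b ha hb c hc, hx N' _ _ (he.append ha) (he.append hb) (e ++ c) (he.append hc)]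
    have h1 : DetElt.ratio ((he.append hc).append hb₀) (he.append hb) =
        DetElt.ratio (hc.append hb₀) hb := by
      apply DetElt.ratio_unique
      rw [List.append_assoc]
      exact he.wedge_append_right (DetElt.ratio_spec (hc.append hb₀) hb)
    have h2 : DetElt.ratio ((he.append hc).append ha₀) (he.append ha) =
        DetElt.ratio (hc.append ha₀) ha := by
      apply DetElt.ratio_unique
      rw [List.append_assoc]
      exact he.wedge_append_right (DetElt.ratio_spec (hc.append ha₀) ha)
    rw [h1, h2]

theorem DetExt.proj_surjective (A : Submodule k V) : Function.Surjective (DetExt.proj A) := by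
  intro f
  have hf : Commensurable (A.map ((f : V ≃ₗ[k] V) : V →ₗ[k] V)) A := f.2
  obtain ⟨s⟩ := DetElt.nonempty hf.symm
  exact ⟨⟨f, s⟩, rfl⟩

/-- The commutator of lifts of two commuting elements is a scalar, independent of the lifts. -/
theorem exists_commutator (A : Submodule k V) {σ τ : glRel A} (h : Commute σ τ) :
    ∃ c : kˣ, ∀ x y : DetExt A, DetExt.proj A x = σ → DetExt.proj A y = τ →
      x * y * x⁻¹ * y⁻¹ = DetExt.incl A c := by
  obtain ⟨x, hx⟩ := DetExt.proj_surjective A σ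
  obtain ⟨y, hy⟩ := DetExt.proj_surjective A τ
  have h1 : x * y * x⁻¹ * y⁻¹ ∈ (DetExt.proj A).ker := by
    rw [MonoidHom.mem_ker, map_mul, map_mul, map_mul, map_inv, map_inv, hx, hy, h.eq]
    group
  rw [DetExt.ker_proj] at h1
  obtain ⟨c, hc⟩ := h1
  refine ⟨c, fun x' y' hx' hy' => ?_⟩
  have lift : ∀ u u' : DetExt A, DetExt.proj A u = DetExt.proj A u' →
      ∃ e : kˣ, u' = DetExt.incl A e * u := by
    intro u u' hu
    have : u' * u⁻¹ ∈ (DetExt.proj A).ker := by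
      rw [MonoidHom.mem_ker, map_mul, map_inv, hu, mul_inv_cancel]
    rw [DetExt.ker_proj] at this
    obtain ⟨e, he⟩ := this
    exact ⟨e, by rw [he, inv_mul_cancel_right]⟩
  obtain ⟨d, rfl⟩ := lift x x' (hx.trans hx'.symm)
  obtain ⟨e, rfl⟩ := lift y y' (hy.trans hy'.symm)
  rw [hc]
  have hd := DetExt.incl_central (A := A) d
  have he := DetExt.incl_central (A := A) e
  generalize DetExt.incl A d = D at *
  generalize DetExt.incl A e = E at *
  calc D * x * (E * y) * (D * x)⁻¹ * (E * y)⁻¹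
      = D * x * y * (E * (x⁻¹ * D⁻¹ * y⁻¹)) * E⁻¹ := by
        rw [mul_inv_rev E y, he y]; group
    _ = D * (x * y * x⁻¹) * D⁻¹ * y⁻¹ := by rw [he]; group
    _ = x * y * x⁻¹ * y⁻¹ := by rw [hd]; group

/-- The commutator `{σ, τ}_A^V` of commuting elements of `GL(V, A)`: the scalar
`σ̃ τ̃ σ̃⁻¹ τ̃⁻¹`, for any lifts `σ̃`, `τ̃` of `σ`, `τ` to the determinantal extension. -/
noncomputable def commutatorPairing (A : Submodule k V) {σ τ : glRel A} (h : Commute σ τ) : kˣ :=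
  (exists_commutator A h).choose

theorem commutatorPairing_spec (A : Submodule k V) {σ τ : glRel A} (h : Commute σ τ)
    (x y : DetExt A) (hx : DetExt.proj A x = σ) (hy : DetExt.proj A y = τ) :
    x * y * x⁻¹ * y⁻¹ = DetExt.incl A (commutatorPairing A h) :=
  (exists_commutator A h).choose_spec x y hx hy

/-- The index `i(f, A, V) = dim (A / A ∩ f A) - dim (f A / A ∩ f A)` of `f ∈ GL(V, A)`. -/
noncomputable def index (A : Submodule k V) (f : glRel A) : ℤ :=
  (Module.finrank k (↥A ⧸
    (A ⊓ A.map ((f : V ≃ₗ[k] V) : V →ₗ[k] V)).submoduleOf A) : ℤ) -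
  (Module.finrank k (↥(A.map ((f : V ≃ₗ[k] V) : V →ₗ[k] V)) ⧸
    (A ⊓ A.map ((f : V ≃ₗ[k] V) : V →ₗ[k] V)).submoduleOf
      (A.map ((f : V ≃ₗ[k] V) : V →ₗ[k] V))) : ℤ)

end Commutator

section Families

variable {k V I : Type*} [Field k] [AddCommGroup V] [Module k V]

/-- The restricted linear group `GL(V, {W_i})`: the automorphisms `σ` of `V` with
`σ ∈ GL(V, W_i)` for all `i` and `σ(W_i) = W_i` for almost all `i`. -/
def restrictedGL (W : I → Submodule k V) : Subgroup (V ≃ₗ[k] V) where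
  carrier := {f | (∀ i, f ∈ glRel (W i)) ∧
    {i | (W i).map (f : V →ₗ[k] V) ≠ W i}.Finite}
  mul_mem' := by
    rintro f g ⟨hf, hf'⟩ ⟨hg, hg'⟩
    refine ⟨fun i => mul_mem (hf i) (hg i), (hf'.union hg').subset ?_⟩
    intro i hi
    by_contra hcon
    simp only [Set.mem_union, Set.mem_ofPred_eq, not_or, not_not] at hcon
    apply hi
    rw [subspace_map_mul, hcon.2, hcon.1]
  one_mem' := by
    refine ⟨fun i => one_mem _, ?_⟩
    simp
  inv_mem' := by
    rintro f ⟨hf, hf'⟩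
    refine ⟨fun i => inv_mem (hf i), hf'.subset ?_⟩
    intro i hi hcon
    apply hi
    conv_lhs => rw [← hcon]
    rw [map_inv_map]

/-- The inclusion `GL(V, {W_i}) → GL(V, W_i)`. -/
def restrictedGL.toGL (W : I → Submodule k V) (i : I) : restrictedGL W →* glRel (W i) :=
  Subgroup.inclusion fun _ hf => hf.1 i

/-- A family `{W_i}` of subspaces of `V` is reciprocity-admissible if `∑ W_i` is commensurable
with `V` and `W_i ∩ ∑_{j ≠ i} W_j` is commensurable with `0` for every `i`. -/
def ReciprocityAdmissible (W : I → Submodule k V) : Prop :=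
  Commensurable (⨆ i, W i) ⊤ ∧
    ∀ i, Commensurable (W i ⊓ ⨆ (j : I) (_ : j ≠ i), W j) ⊥

end Families
end ACK

namespace ACK

section Reciprocity

variable {k V I : Type*} [Field k] [AddCommGroup V] [Module k V]

/-! For commuting automorphisms `σ`, `τ` write `⟨A⟩` for the commutator on `A` multiplied by the
sign `(-1) ^ (i(σ) i(τ))`. Three properties of `⟨A⟩` give the reciprocity law.

Triviality: `⟨A⟩ = 1` if `A` is finite over a subspace `N` with `σ N = τ N = N`
(`signedPairing_eq_one_of_fixed`). A basis `a` of `A / N` is carried to bases of `σ A`, `τ A` and `σ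
τ A` over the same `N`, and lifts whose coefficients in these bases are `1` commute. This covers
finite-dimensional `A`, with `N = 0`, and also `A = V`.

Multiplicativity: `⟨A ⊕ B⟩ = ⟨A⟩ ⟨B⟩` (`signedPairing_sup_of_disjoint`). Lifts on `A ⊕ B` are tensor
products of lifts on the summands. Reordering exterior products costs signs, which the bilinear form
`i(σ) i(τ)` absorbs exactly; without the sign the commutator is multiplicative only up to `(-1) ^
(i(σ, A) i(τ, B) + i(σ, B) i(τ, A))`. With triviality in finite dimension it follows that `⟨A⟩`
depends only on the commensurability class of `A` and that finite-dimensional intersections `A ∩ B`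
do no harm (`signedPairing_sup`).

Globalisation: let `F` be the finite set of indices at which `σ` or `τ` moves the subspace. The sum
of all the other members is fixed as a whole, so its pairing is `1`, however many there are. Adding
the members indexed by `F` one at a time shows that the product of the factors is the pairing of the
sum of the family (`signedPairing_iSup`). This sum has finite codimension in `V`, and `⟨V⟩ = 1`. -/

/-! ### Commutators and indices in terms of bases -/

theorem DetElt.coeff_smul {A B : Submodule k V} (c : kˣ) (s : DetElt A B) {N : Submodule k V}
    {a b : List V} (ha : IsRelBasis N A a) (hb : IsRelBasis N B b) :
    (s.smul c).coeff N a b ha hb = c * s.coeff N a b ha hb := rfl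

/-- There is an element of `(A | B)` with a prescribed matrix coefficient. -/
theorem DetElt.exists_coeff_eq {A B N : Submodule k V} {a b : List V} (ha : IsRelBasis N A a)
    (hb : IsRelBasis N B b) (x : kˣ) : ∃ s : DetElt A B, s.coeff N a b ha hb = x := by
  have hAB : Commensurable A B := commensurable_iff.2
    ⟨ha.almostLE.trans (.of_le hb.le), hb.almostLE.trans (.of_le ha.le)⟩
  obtain ⟨s⟩ := DetElt.nonempty hAB
  exact ⟨s.smul (x * (s.coeff N a b ha hb)⁻¹), by rw [coeff_smul, inv_mul_cancel_right]⟩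

theorem DetExt.coeff_eq_of_eq {A : Submodule k V} {x y : DetExt A} (h : x = y)
    {N : Submodule k V} {a b : List V} (ha : IsRelBasis N A a)
    (hx : IsRelBasis N (A.map ((x.toGL : V ≃ₗ[k] V) : V →ₗ[k] V)) b)
    (hy : IsRelBasis N (A.map ((y.toGL : V ≃ₗ[k] V) : V →ₗ[k] V)) b) :
    x.elt.coeff N a b ha hx = y.elt.coeff N a b ha hy := by
  subst h; rfl

/-- The commutator pairing of two automorphisms in terms of matrix coefficients. -/
theorem commutatorPairing_coeff {A : Submodule k V} {σ τ : glRel A} (h : Commute σ τ)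
    (s : DetElt A (A.map ((σ : V ≃ₗ[k] V) : V →ₗ[k] V)))
    (t : DetElt A (A.map ((τ : V ≃ₗ[k] V) : V →ₗ[k] V)))
    {N : Submodule k V} {a b d e : List V} (ha : IsRelBasis N A a)
    (hb : IsRelBasis N (A.map ((σ : V ≃ₗ[k] V) : V →ₗ[k] V)) b)
    (hd : IsRelBasis N (A.map ((τ : V ≃ₗ[k] V) : V →ₗ[k] V)) d)
    (he : IsRelBasis N ((A.map ((τ : V ≃ₗ[k] V) : V →ₗ[k] V)).map
      ((σ : V ≃ₗ[k] V) : V →ₗ[k] V)) e)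
    (he' : IsRelBasis N ((A.map ((σ : V ≃ₗ[k] V) : V →ₗ[k] V)).map
      ((τ : V ≃ₗ[k] V) : V →ₗ[k] V)) e) :
    s.coeff N a b ha hb * (t.map (σ : V ≃ₗ[k] V)).coeff N b e hb he =
      commutatorPairing A h *
        (t.coeff N a d ha hd * (s.map (τ : V ≃ₗ[k] V)).coeff N d e hd he') := by
  let x : DetExt A := ⟨σ, s⟩
  let y : DetExt A := ⟨τ, t⟩
  -- Without inverses the commutator relation reads `x y = c · y x`, so that only coefficients of
  -- products are needed.
  have h1 : x * y = DetExt.scale (commutatorPairing A h) (y * x) := by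
    have := commutatorPairing_spec A h x y rfl rfl
    rw [mul_inv_eq_iff_eq_mul, mul_inv_eq_iff_eq_mul, DetExt.incl_apply, DetExt.scale_mul,
      one_mul, DetExt.scale_mul] at this
    exact this
  have he₁ : IsRelBasis N (A.map (((x * y).toGL : V ≃ₗ[k] V) : V →ₗ[k] V)) e := by
    change IsRelBasis N (A.map ((((σ : V ≃ₗ[k] V) * (τ : V ≃ₗ[k] V)) : V ≃ₗ[k] V) : V →ₗ[k] V)) e
    rwa [subspace_map_mul]
  have he₂ : IsRelBasis N (A.map (((y * x).toGL : V ≃ₗ[k] V) : V →ₗ[k] V)) e := by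
    change IsRelBasis N (A.map ((((τ : V ≃ₗ[k] V) * (σ : V ≃ₗ[k] V)) : V ≃ₗ[k] V) : V →ₗ[k] V)) e
    rwa [subspace_map_mul]
  have h2 := DetExt.coeff_eq_of_eq h1 ha he₁ he₂
  -- The contractions are computed over `N` itself, with the empty basis of `N / N`; they pass
  -- through `b` for `x y` and through `d` for `y x`.
  have h3 := DetExt.mul_coeff x y ha he₁ (IsRelBasis.nil N) hb
  have h4 := DetExt.mul_coeff y x ha he₂ (IsRelBasis.nil N) hd
  exact h3.symm.trans (h2.trans (congrArg (commutatorPairing A h * ·) h4))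

theorem IsRelBasis.finrank_eq {N A : Submodule k V} {a : List V} (h : IsRelBasis N A a) :
    Module.finrank k (↥A ⧸ N.submoduleOf A) = a.length := by
  have h1 := finrank_span_eq_card h.1
  rw [h.span_range, Fintype.card_fin] at h1
  rw [← h1]
  refine LinearEquiv.finrank_eq (LinearEquiv.trans (Submodule.quotEquivOfEq _ _ ?_)
    ((N.mkQ.domRestrict A).quotKerEquivRange.trans (LinearEquiv.ofEq _ _ ?_)))
  · ext x
    simp [Submodule.submoduleOf]
  · rw [LinearMap.range_domRestrict]

/-- The index of `f` is the difference of the relative dimensions of `A` and `f A` over any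
common subspace of finite codimension. -/
theorem index_eq {A : Submodule k V} (f : glRel A) {N : Submodule k V} {a b : List V}
    (ha : IsRelBasis N A a)
    (hb : IsRelBasis N (A.map ((f : V ≃ₗ[k] V) : V →ₗ[k] V)) b) :
    index A f = (a.length : ℤ) - b.length := by
  -- The list `c` is a basis of `(A ∩ f A) / N`; its length enters both relative dimensions and
  -- cancels.
  obtain ⟨c, hc⟩ := ((AlmostLE.of_le inf_le_left).trans ha.almostLE).exists_relBasis
    (le_inf ha.le hb.le)
  obtain ⟨h1, h2⟩ := commensurable_iff.1 f.2
  obtain ⟨a', ha'⟩ := ((AlmostLE.of_le le_rfl).inf h2).exists_relBasis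
    (N := A ⊓ A.map ((f : V ≃ₗ[k] V) : V →ₗ[k] V)) inf_le_left
  obtain ⟨b', hb'⟩ := (h1.inf (AlmostLE.of_le le_rfl)).exists_relBasis
    (N := A ⊓ A.map ((f : V ≃ₗ[k] V) : V →ₗ[k] V)) inf_le_right
  have h3 := ha.length_eq (hc.append ha')
  have h4 := hb.length_eq (hc.append hb')
  rw [List.length_append] at h3 h4
  rw [index, ha'.finrank_eq, hb'.finrank_eq]
  omega

/-! ### Signs, bases and determinant lines of direct sums -/

theorem units_neg_one_zpow_congr {m n : ℤ} (h : m % 2 = n % 2) : (-1 : kˣ) ^ m = (-1) ^ n := by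
  have key : ∀ m : ℤ, (-1 : kˣ) ^ m = (-1) ^ (m % 2) := by
    intro m
    conv_lhs => rw [← Int.emod_add_mul_ediv m 2, zpow_add, zpow_mul]
    simp
  rw [key m, key n, h]

theorem units_neg_one_pow_congr {m n : ℕ} (h : m % 2 = n % 2) : (-1 : kˣ) ^ m = (-1) ^ n := by
  rw [← zpow_natCast, ← zpow_natCast]
  exact units_neg_one_zpow_congr (by omega)

/-- The quotient by a larger subspace preserves proportionality of exterior products. -/
theorem wedge_smul_of_le {N L : Submodule k V} (hNL : N ≤ L) {a a' : List V} {α : kˣ}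
    (h : wedge N a' = α • wedge N a) : wedge L a' = α • wedge L a := by
  let q : (V ⧸ N) →ₗ[k] (V ⧸ L) := Submodule.mapQ N L LinearMap.id hNL
  have key : ∀ b : List V, wedge L b = ExteriorAlgebra.map q (wedge N b) := by
    intro b
    rw [wedge, wedge, map_list_prod, List.map_map]
    congr 2
    ext v
    simp [q]
  rw [key, key, h]
  simp [Units.smul_def]

theorem wedge_swap_singleton (N : Submodule k V) (v : V) (a : List V) :
    wedge N (a ++ [v]) = (-1 : kˣ) ^ a.length • wedge N (v :: a) := by
  induction a with
  | nil => simp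
  | cons u a ih =>
    have h := eq_neg_of_add_eq_zero_left
      (ExteriorAlgebra.ι_add_mul_swap (R := k) (N.mkQ u) (N.mkQ v))
    rw [List.cons_append, wedge_cons, ih, wedge_cons, wedge_cons, wedge_cons, mul_smul_comm,
      ← mul_assoc, h, List.length_cons, pow_succ, mul_smul, neg_mul, mul_assoc]
    simp [Units.smul_def]

theorem wedge_swap (N : Submodule k V) (a b : List V) :
    wedge N (b ++ a) = (-1 : kˣ) ^ (a.length * b.length) • wedge N (a ++ b) := by
  induction a with
  | nil => simp
  | cons u a ih =>
    rw [List.append_cons, wedge_append, wedge_swap_singleton, smul_mul_assoc, wedge_cons,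
      mul_assoc, ← wedge_append, ih, mul_smul_comm, smul_smul, ← pow_add, List.cons_append,
      wedge_cons, List.length_cons, add_mul, one_mul, add_comm]

/-- Since `N ≤ A` and `A ∩ X = 0`, the modular law gives `(N + X) ∩ A = N`, so `A / N` meets the
kernel of `V / N → V / (N + X)` trivially. -/
theorem IsRelBasis.sup_right {N A X : Submodule k V} {a : List V} (h : IsRelBasis N A a)
    (hX : Disjoint A X) : IsRelBasis (N ⊔ X) (A ⊔ X) a := by
  constructor
  · let q : (V ⧸ N) →ₗ[k] (V ⧸ (N ⊔ X)) := Submodule.mapQ N (N ⊔ X) LinearMap.id le_sup_left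
    refine LinearIndependent.map (f := q) h.1 ?_
    rw [h.span_range, Submodule.disjoint_def]
    rintro _ ⟨v, hv, rfl⟩ hq
    have hv' : v ∈ N ⊔ X := by simpa [q] using hq
    have : v ∈ (N ⊔ X) ⊓ A := ⟨hv', hv⟩
    rw [sup_inf_assoc_of_le X h.le, hX.symm.eq_bot, sup_bot_eq] at this
    simpa using this
  · rw [sup_right_comm, h.2]

/-- The two lists are bases of the successive quotients of the chain `N + M ≤ A + M ≤ A + B`. -/
theorem IsRelBasis.sup {N A M B : Submodule k V} {a b : List V} (ha : IsRelBasis N A a)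
    (hb : IsRelBasis M B b) (h : Disjoint A B) : IsRelBasis (N ⊔ M) (A ⊔ B) (a ++ b) := by
  refine (ha.sup_right (h.mono_right hb.le)).append ?_
  rw [sup_comm A M, sup_comm A B]
  exact hb.sup_right h.symm

/-- The coefficient of an element over a refinement of both summands of a direct sum. -/
theorem DetElt.coeff_refine {C C' : Submodule k V} (u : DetElt C C')
    {N N₁ M M₁ : Submodule k V} {a a' b b' c e : List V}
    (hc : IsRelBasis N₁ N c) (he : IsRelBasis M₁ M e) (hNM : Disjoint N M)
    (H : IsRelBasis (N ⊔ M) C (a ++ b)) (H' : IsRelBasis (N ⊔ M) C' (a' ++ b'))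
    (H₁ : IsRelBasis (N₁ ⊔ M₁) C ((c ++ a) ++ (e ++ b)))
    (H₁' : IsRelBasis (N₁ ⊔ M₁) C' ((c ++ a') ++ (e ++ b'))) :
    u.coeff _ _ _ H₁ H₁' =
      (-1) ^ (e.length * (a.length + a'.length)) * u.coeff _ _ _ H H' := by
  have hce := hc.sup he hNM
  -- The law `stable` strips off only an initial segment, so `e` has to be moved to the left past
  -- `x`.
  have key : ∀ x y : List V, wedge (N₁ ⊔ M₁) ((c ++ x) ++ (e ++ y)) =
      (-1 : kˣ) ^ (e.length * x.length) • wedge (N₁ ⊔ M₁) ((c ++ e) ++ (x ++ y)) := by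
    intro x y
    have h1 := wedge_swap (N₁ ⊔ M₁) e x
    simp only [wedge_append] at h1 ⊢
    rw [mul_assoc, ← mul_assoc (wedge _ x), h1, smul_mul_assoc, mul_smul_comm, mul_assoc,
      mul_assoc]
  have h2 := u.wedge_law _ _ _ _ _ (hce.append H) H₁ (hce.append H') H₁' _ _ (key a b) (key a' b')
  rw [u.stable _ _ _ _ _ hce H H'] at h2
  -- The sign on the `C` side is its own inverse, so it can be moved across and joined to the sign
  -- on the `C'` side.
  have h3 : ((-1 : kˣ) ^ (e.length * a.length)) * (-1) ^ (e.length * a.length) = 1 := by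
    rw [← mul_pow]; simp
  rw [mul_add, pow_add, mul_assoc, ← h2, ← mul_assoc, h3, one_mul]

/-- The tensor product `(A | A') ⊗ (B | B') → (A ⊕ B | A' ⊕ B')`. -/
theorem DetElt.exists_sup {A A' B B' : Submodule k V} (h : Disjoint A B) (h' : Disjoint A' B')
    (hA : Commensurable A A') (hB : Commensurable B B') (s : DetElt A A') (t : DetElt B B') :
    ∃ u : DetElt (A ⊔ B) (A' ⊔ B'), ∀ (N M : Submodule k V) (a a' b b' : List V)
      (ha : IsRelBasis N A a) (ha' : IsRelBasis N A' a') (hb : IsRelBasis M B b)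
      (hb' : IsRelBasis M B' b'),
      u.coeff (N ⊔ M) (a ++ b) (a' ++ b') (ha.sup hb h) (ha'.sup hb' h') =
        (-1) ^ (b.length * (a.length + a'.length)) *
          (s.coeff N a a' ha ha' * t.coeff M b b' hb hb') := by
  have common : ∀ {X X' : Submodule k V}, Commensurable X X' →
      ∃ (N : Submodule k V) (x x' : List V), IsRelBasis N X x ∧ IsRelBasis N X' x' := by
    intro X X' hX
    obtain ⟨N, c, b, hc, hb⟩ := exists_common hX.symm (IsRelBasis.nil X)
    exact ⟨N, c, b, hc, hb⟩
  obtain ⟨N₀, a₀, a₀', ha₀, ha₀'⟩ := common hA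
  obtain ⟨M₀, b₀, b₀', hb₀, hb₀'⟩ := common hB
  -- One coefficient determines the element, so the formula is imposed at one choice of subspaces
  -- and bases. What remains is to show that it persists at all others, by comparison over `N ⊓ N₀`
  -- and `M ⊓ M₀`.
  obtain ⟨u, hu⟩ := exists_coeff_eq (ha₀.sup hb₀ h) (ha₀'.sup hb₀' h')
    ((-1) ^ (b₀.length * (a₀.length + a₀'.length)) *
      (s.coeff N₀ a₀ a₀' ha₀ ha₀' * t.coeff M₀ b₀ b₀' hb₀ hb₀'))
  refine ⟨u, fun N M a a' b b' ha ha' hb hb' => ?_⟩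
  obtain ⟨c, hc⟩ := ((AlmostLE.of_le le_rfl).inf
    ((AlmostLE.of_le ha.le).trans ha₀.almostLE)).exists_relBasis (N := N ⊓ N₀) inf_le_left
  obtain ⟨c₀, hc₀⟩ := (((AlmostLE.of_le ha₀.le).trans ha.almostLE).inf
    (AlmostLE.of_le le_rfl)).exists_relBasis (N := N ⊓ N₀) inf_le_right
  obtain ⟨e, he⟩ := ((AlmostLE.of_le le_rfl).inf
    ((AlmostLE.of_le hb.le).trans hb₀.almostLE)).exists_relBasis (N := M ⊓ M₀) inf_le_left
  obtain ⟨e₀, he₀⟩ := (((AlmostLE.of_le hb₀.le).trans hb.almostLE).inf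
    (AlmostLE.of_le le_rfl)).exists_relBasis (N := M ⊓ M₀) inf_le_right
  have r1 := u.coeff_refine hc he (h.mono ha.le hb.le) (ha.sup hb h) (ha'.sup hb' h')
    ((hc.append ha).sup (he.append hb) h) ((hc.append ha').sup (he.append hb') h')
  have r2 := u.coeff_refine hc₀ he₀ (h.mono ha₀.le hb₀.le) (ha₀.sup hb₀ h) (ha₀'.sup hb₀' h')
    ((hc₀.append ha₀).sup (he₀.append hb₀) h) ((hc₀.append ha₀').sup (he₀.append hb₀') h')
  have s1 := s.stable _ _ _ _ _ hc ha ha'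
  have s2 := s.stable _ _ _ _ _ hc₀ ha₀ ha₀'
  have t1 := t.stable _ _ _ _ _ he hb hb'
  have t2 := t.stable _ _ _ _ _ he₀ hb₀ hb₀'
  obtain ⟨α, hα⟩ := (hc₀.append ha₀).exists_unit (hc.append ha)
  obtain ⟨α', hα'⟩ := (hc₀.append ha₀').exists_unit (hc.append ha')
  obtain ⟨β, hβ⟩ := (he₀.append hb₀).exists_unit (he.append hb)
  obtain ⟨β', hβ'⟩ := (he₀.append hb₀').exists_unit (he.append hb')
  have w : ∀ (p p' q q' : List V) (γ δ : kˣ), wedge (N ⊓ N₀) p' = γ • wedge (N ⊓ N₀) p →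
      wedge (M ⊓ M₀) q' = δ • wedge (M ⊓ M₀) q →
      wedge (N ⊓ N₀ ⊔ M ⊓ M₀) (p' ++ q') = (γ * δ) • wedge (N ⊓ N₀ ⊔ M ⊓ M₀) (p ++ q) := by
    intro p p' q q' γ δ h1 h2
    rw [wedge_append, wedge_append, wedge_smul_of_le le_sup_left h1,
      wedge_smul_of_le le_sup_right h2, smul_mul_smul_comm]
  have ws := s.wedge_law _ _ _ _ _ (hc₀.append ha₀) (hc.append ha) (hc₀.append ha₀')
    (hc.append ha') α α' hα hα'
  have wt := t.wedge_law _ _ _ _ _ (he₀.append hb₀) (he.append hb) (he₀.append hb₀')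
    (he.append hb') β β' hβ hβ'
  have wu := u.wedge_law _ _ _ _ _ ((hc₀.append ha₀).sup (he₀.append hb₀) h)
    ((hc.append ha).sup (he.append hb) h) ((hc₀.append ha₀').sup (he₀.append hb₀') h')
    ((hc.append ha').sup (he.append hb') h') _ _ (w _ _ _ _ _ _ hα hβ) (w _ _ _ _ _ _ hα' hβ')
  rw [s1, s2] at ws
  rw [t1, t2] at wt
  rw [r1, r2, hu] at wu
  have l1 := (hc₀.append ha₀).length_eq (hc.append ha)
  have l2 := (hc₀.append ha₀').length_eq (hc.append ha')
  have l3 := (he₀.append hb₀).length_eq (he.append hb)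
  simp only [List.length_append] at l1 l2 l3
  -- This is what dictates the sign in the formula. Over the common refinement the lists of `B` have
  -- the same total length, and `|a| + |a'|` has the same parity as `|a₀| + |a₀'|`, because each
  -- refinement prolongs both lists equally.
  have sgn : (-1 : kˣ) ^ (e₀.length * (a₀.length + a₀'.length)) *
      (-1) ^ (b₀.length * (a₀.length + a₀'.length)) =
      (-1) ^ (e.length * (a.length + a'.length)) * (-1) ^ (b.length * (a.length + a'.length)) := by
    rw [← pow_add, ← pow_add, ← add_mul, ← add_mul, l3]
    apply units_neg_one_pow_congr
    rw [Nat.mul_mod, Nat.mul_mod (e.length + b.length)]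
    congr 2
    omega
  have h5 : (α * β) * (-1) ^ (e.length * (a.length + a'.length)) *
      u.coeff (N ⊔ M) (a ++ b) (a' ++ b') (ha.sup hb h) (ha'.sup hb' h') =
      (α * β) * (-1) ^ (e.length * (a.length + a'.length)) *
        ((-1) ^ (b.length * (a.length + a'.length)) *
          (s.coeff N a a' ha ha' * t.coeff M b b' hb hb')) := by
    calc _ = _ := by rw [mul_assoc]
      _ = _ := wu
      _ = ((-1) ^ (e₀.length * (a₀.length + a₀'.length)) *
            (-1) ^ (b₀.length * (a₀.length + a₀'.length))) *
          ((α' * s.coeff N₀ a₀ a₀' ha₀ ha₀') * (β' * t.coeff M₀ b₀ b₀' hb₀ hb₀')) := by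
        simp only [mul_assoc, mul_left_comm, mul_comm]
      _ = _ := by
        rw [sgn, ← ws, ← wt]
        simp only [mul_assoc, mul_left_comm, mul_comm]
  exact mul_left_cancel h5

/-! ### The signed pairing and its triviality over fixed subspaces -/

/-- The commutator pairing corrected by the sign `(-1) ^ (i(σ, A, V) i(τ, A, V))`. -/
noncomputable def signedPairing (A : Submodule k V) {σ τ : V ≃ₗ[k] V} (hσ : σ ∈ glRel A)
    (hτ : τ ∈ glRel A) (h : Commute σ τ) : kˣ :=
  (-1) ^ (index A ⟨σ, hσ⟩ * index A ⟨τ, hτ⟩) *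
    commutatorPairing A (σ := ⟨σ, hσ⟩) (τ := ⟨τ, hτ⟩) (Subtype.ext h)

theorem signedPairing_congr {A B : Submodule k V} (hAB : A = B) {σ τ : V ≃ₗ[k] V}
    (hσ : σ ∈ glRel A) (hτ : τ ∈ glRel A) (hσ' : σ ∈ glRel B) (hτ' : τ ∈ glRel B)
    (h : Commute σ τ) : signedPairing A hσ hτ h = signedPairing B hσ' hτ' h := by
  subst hAB; rfl

theorem mem_glRel_iff {A : Submodule k V} {f : V ≃ₗ[k] V} :
    f ∈ glRel A ↔ Commensurable (A.map (f : V →ₗ[k] V)) A := Iff.rfl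

theorem mem_glRel_of_commensurable {A B : Submodule k V} (h : Commensurable A B)
    {f : V ≃ₗ[k] V} (hf : f ∈ glRel A) : f ∈ glRel B :=
  ((h.map _).symm.trans (mem_glRel_iff.1 hf)).trans h

theorem mem_glRel_sup {A B : Submodule k V} {f : V ≃ₗ[k] V} (hA : f ∈ glRel A)
    (hB : f ∈ glRel B) : f ∈ glRel (A ⊔ B) := by
  rw [mem_glRel_iff, commensurable_iff] at *
  rw [Submodule.map_sup]
  exact ⟨(hA.1.trans (.of_le le_sup_left)).sup (hB.1.trans (.of_le le_sup_right)),
    (hA.2.trans (.of_le le_sup_left)).sup (hB.2.trans (.of_le le_sup_right))⟩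

theorem map_comm {σ τ : V ≃ₗ[k] V} (h : Commute σ τ) (A : Submodule k V) :
    (A.map (σ : V →ₗ[k] V)).map (τ : V →ₗ[k] V) =
      (A.map (τ : V →ₗ[k] V)).map (σ : V →ₗ[k] V) := by
  rw [← subspace_map_mul, ← subspace_map_mul, h.eq]

/-- The pairing is trivial if `A` is finite over a subspace fixed by both automorphisms. -/
theorem signedPairing_eq_one_of_fixed {A N : Submodule k V} (hNA : N ≤ A) (hA : AlmostLE A N)
    {σ τ : V ≃ₗ[k] V} (hσN : N.map (σ : V →ₗ[k] V) = N) (hτN : N.map (τ : V →ₗ[k] V) = N)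
    (hσ : σ ∈ glRel A) (hτ : τ ∈ glRel A) (h : Commute σ τ) : signedPairing A hσ hτ h = 1 := by
  obtain ⟨a, ha⟩ := hA.exists_relBasis hNA
  have hb := ha.map σ
  have hd := ha.map τ
  have he := hd.map σ
  have he' := hb.map τ
  -- By commutativity one list serves as the basis for both orders of the product.
  have hστ : (a.map σ).map τ = (a.map τ).map σ := by
    rw [List.map_map, List.map_map]
    congr 1
    ext v
    exact (LinearEquiv.congr_fun h.eq v).symm
  rw [hσN] at hb
  rw [hτN] at hd
  rw [hτN, hσN] at he
  rw [hσN, hτN, hστ] at he'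
  -- The lifts send the chosen bases to each other with coefficient `1`. Transport by `σ` or `τ`
  -- preserves this, as `N` is fixed, and both sides of `commutatorPairing_coeff` reduce to `1`
  -- times the pairing or less.
  obtain ⟨s, hs⟩ := DetElt.exists_coeff_eq ha hb 1
  obtain ⟨t, ht⟩ := DetElt.exists_coeff_eq ha hd 1
  have hc := commutatorPairing_coeff (σ := ⟨σ, hσ⟩) (τ := ⟨τ, hτ⟩) (Subtype.ext h) s t
    ha hb hd he he'
  have inv_map : ∀ f : V ≃ₗ[k] V, N.map (f : V →ₗ[k] V) = N →
      N.map ((f⁻¹ : V ≃ₗ[k] V) : V →ₗ[k] V) = N := by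
    intro f hf
    conv_lhs => rw [← hf, map_inv_map]
  have list_inv : ∀ (f : V ≃ₗ[k] V) (l : List V), (l.map f).map (f⁻¹ : V ≃ₗ[k] V) = l := by
    intro f l
    rw [List.map_map]
    convert List.map_id l
    ext v
    exact f.symm_apply_apply v
  have h1 : (t.map σ).coeff N (a.map σ) ((a.map τ).map σ) hb he = 1 :=
    (t.coeff_congr (inv_map σ hσN) (list_inv σ a) (list_inv σ _) _ _ ha hd).trans ht
  have h2 : (s.map τ).coeff N (a.map τ) ((a.map τ).map σ) hd he' = 1 :=
    (s.coeff_congr (inv_map τ hτN) (list_inv τ a) (by rw [← hστ, list_inv]) _ _ ha hb).trans hs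
  have h3 : (1 : kˣ) * 1 = commutatorPairing A (σ := ⟨σ, hσ⟩) (τ := ⟨τ, hτ⟩)
      (Subtype.ext h) * (1 * 1) := by
    exact (congrArg₂ (· * ·) hs h1).symm.trans (hc.trans (congrArg _ (congrArg₂ (· * ·) ht h2)))
  have h4 : index A ⟨σ, hσ⟩ = 0 := by
    rw [index_eq ⟨σ, hσ⟩ ha hb, List.length_map, sub_self]
  rw [signedPairing, h4, zero_mul, zpow_zero, one_mul]
  simpa using h3.symm

/-! ### Multiplicativity in direct sums -/

/-- A subspace of finite codimension in four commensurable subspaces, with bases. -/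
theorem exists_bases {A B C D : Submodule k V} (hB : Commensurable B A) (hC : Commensurable C A)
    (hD : Commensurable D A) : ∃ (N : Submodule k V) (a b c d : List V),
      IsRelBasis N A a ∧ IsRelBasis N B b ∧ IsRelBasis N C c ∧ IsRelBasis N D d := by
  obtain ⟨M, a, b, c, ha, hb, hc⟩ := DetExt.exists_common_two (IsRelBasis.nil A) hB hC
  obtain ⟨N, g, d, hg, hd⟩ := DetElt.exists_common hD ha
  exact ⟨N, g ++ a, g ++ b, g ++ c, d, hg.append ha, hg.append hb, hg.append hc, hd⟩

/-- The subscripts 1 and 2 of the coefficients and of `c` refer to the two summands, the `e` and `f`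
are the signs of the tensor products. All matrix coefficients cancel, which leaves a relation
between pairings and signs alone. -/
theorem commutator_mul_aux {G : Type*} [CommGroup G]
    {x₁ x₂ z₁ z₂ p₁ p₂ q₁ q₂ c₁ c₂ c e₁ e₂ f₁ f₂ : G}
    (h₁ : x₁ * z₁ = c₁ * (p₁ * q₁)) (h₂ : x₂ * z₂ = c₂ * (p₂ * q₂))
    (h : e₁ * (x₁ * x₂) * (e₂ * (z₁ * z₂)) = c * (f₁ * (p₁ * p₂) * (f₂ * (q₁ * q₂)))) :
    e₁ * e₂ * (c₁ * c₂) = f₁ * f₂ * c := by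
  have h3 : (e₁ * e₂ * (c₁ * c₂)) * ((p₁ * q₁) * (p₂ * q₂)) =
      (f₁ * f₂ * c) * ((p₁ * q₁) * (p₂ * q₂)) := by
    calc _ = e₁ * e₂ * ((c₁ * (p₁ * q₁)) * (c₂ * (p₂ * q₂))) := by
          simp only [mul_left_comm, mul_comm]
      _ = e₁ * (x₁ * x₂) * (e₂ * (z₁ * z₂)) := by
          rw [← h₁, ← h₂]; simp only [mul_left_comm, mul_comm]
      _ = _ := by
          rw [h]; simp only [mul_left_comm, mul_comm]
  exact mul_right_cancel h3

/-- Reduces the comparison of signed pairings to the parity of one integer. -/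
theorem units_eq_of_signs {e f m n : ℤ} {c c' : kˣ}
    (h : (-1 : kˣ) ^ e * c' = (-1) ^ f * c) (hn : 2 ∣ m + e + f - n) :
    (-1) ^ m * c = (-1) ^ n * c' := by
  have h1 : (-1 : kˣ) ^ m = (-1) ^ (n - e + f) := units_neg_one_zpow_congr (by omega)
  have h2 : c' = (-1 : kˣ) ^ (-e) * ((-1) ^ f * c) := by
    rw [← h, ← mul_assoc, ← zpow_add, neg_add_cancel, zpow_zero, one_mul]
  rw [h1, h2, ← mul_assoc, ← mul_assoc, ← zpow_add, ← zpow_add]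
  congr 3

/-- Multiplicativity of the signed pairing in direct sums. -/
theorem signedPairing_sup_of_disjoint {A B : Submodule k V} (hAB : Disjoint A B)
    {σ τ : V ≃ₗ[k] V} (hσA : σ ∈ glRel A) (hτA : τ ∈ glRel A) (hσB : σ ∈ glRel B)
    (hτB : τ ∈ glRel B) (hσ : σ ∈ glRel (A ⊔ B)) (hτ : τ ∈ glRel (A ⊔ B)) (h : Commute σ τ) :
    signedPairing (A ⊔ B) hσ hτ h = signedPairing A hσA hτA h * signedPairing B hσB hτB h := by
  have hστA : Commensurable ((A.map (τ : V →ₗ[k] V)).map (σ : V →ₗ[k] V)) A :=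
    (Commensurable.map hτA _).trans hσA
  have hστB : Commensurable ((B.map (τ : V →ₗ[k] V)).map (σ : V →ₗ[k] V)) B :=
    (Commensurable.map hτB _).trans hσB
  have dmap : ∀ {X Y : Submodule k V}, Disjoint X Y → ∀ f : V ≃ₗ[k] V,
      Disjoint (X.map (f : V →ₗ[k] V)) (Y.map (f : V →ₗ[k] V)) := fun hXY f =>
    Submodule.disjoint_map f.injective hXY
  obtain ⟨N, a, a₁, a₂, a₃, ha, ha₁, ha₂, ha₃⟩ := exists_bases hσA hτA hστA
  obtain ⟨M, b, b₁, b₂, b₃, hb, hb₁, hb₂, hb₃⟩ := exists_bases hσB hτB hστB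
  have ha₃' : IsRelBasis N ((A.map (σ : V →ₗ[k] V)).map (τ : V →ₗ[k] V)) a₃ := by
    rwa [map_comm h]
  have hb₃' : IsRelBasis M ((B.map (σ : V →ₗ[k] V)).map (τ : V →ₗ[k] V)) b₃ := by
    rwa [map_comm h]
  obtain ⟨sA⟩ := DetElt.nonempty (Commensurable.symm hσA)
  obtain ⟨sB⟩ := DetElt.nonempty (Commensurable.symm hσB)
  obtain ⟨tA⟩ := DetElt.nonempty (Commensurable.symm hτA)
  obtain ⟨tB⟩ := DetElt.nonempty (Commensurable.symm hτB)
  have cA := commutatorPairing_coeff (σ := ⟨σ, hσA⟩) (τ := ⟨τ, hτA⟩) (Subtype.ext h) sA tA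
    ha ha₁ ha₂ ha₃ ha₃'
  have cB := commutatorPairing_coeff (σ := ⟨σ, hσB⟩) (τ := ⟨τ, hτB⟩) (Subtype.ext h) sB tB
    hb hb₁ hb₂ hb₃ hb₃'
  -- The lifts on `A ⊔ B` are the tensor products of the lifts on `A` and `B`.
  obtain ⟨s, hs⟩ := DetElt.exists_sup hAB (dmap hAB σ) (Commensurable.symm hσA)
    (Commensurable.symm hσB) sA sB
  obtain ⟨t, ht⟩ := DetElt.exists_sup hAB (dmap hAB τ) (Commensurable.symm hτA)
    (Commensurable.symm hτB) tA tB
  have msup : ∀ f : V ≃ₗ[k] V, (A ⊔ B).map (f : V →ₗ[k] V) =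
    A.map (f : V →ₗ[k] V) ⊔ B.map (f : V →ₗ[k] V) := fun f => Submodule.map_sup _ _ _
  have H₀ := ha.sup hb hAB
  have H₁ := ha₁.sup hb₁ (dmap hAB σ)
  have H₂ := ha₂.sup hb₂ (dmap hAB τ)
  have H₃ := ha₃.sup hb₃ (dmap (dmap hAB τ) σ)
  have H₃' := ha₃'.sup hb₃' (dmap (dmap hAB σ) τ)
  rw [← msup] at H₁ H₂
  rw [← Submodule.map_sup, ← msup] at H₃ H₃'
  have c := commutatorPairing_coeff (σ := ⟨σ, hσ⟩) (τ := ⟨τ, hτ⟩) (Subtype.ext h)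
    (s.cast (msup σ)) (t.cast (msup τ)) H₀ H₁ H₂ H₃ H₃'
  have e1 : (s.cast (msup σ)).coeff _ _ _ H₀ H₁ = _ := hs N M a a₁ b b₁ ha ha₁ hb hb₁
  have e2 : (t.cast (msup τ)).coeff _ _ _ H₀ H₂ = _ := ht N M a a₂ b b₂ ha ha₂ hb hb₂
  have e3 : ((t.cast (msup τ)).map σ).coeff _ _ _ H₁ H₃ = _ :=
    (t.coeff_congr (Submodule.map_sup _ _ _) List.map_append List.map_append _ _ _ _).trans
      (ht _ _ _ _ _ _ ha₁.map_inv ha₃.map_inv hb₁.map_inv hb₃.map_inv)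
  have e4 : ((s.cast (msup σ)).map τ).coeff _ _ _ H₂ H₃' = _ :=
    (s.coeff_congr (Submodule.map_sup _ _ _) List.map_append List.map_append _ _ _ _).trans
      (hs _ _ _ _ _ _ ha₂.map_inv ha₃'.map_inv hb₂.map_inv hb₃'.map_inv)
  simp only [List.length_map] at e3 e4
  have c' := (congrArg₂ (· * ·) e1 e3).symm.trans (c.trans (congrArg _ (congrArg₂ (· * ·) e2 e4)))
  have c'' := commutator_mul_aux cA cB c'
  have iσA := index_eq ⟨σ, hσA⟩ ha ha₁
  have iσB := index_eq ⟨σ, hσB⟩ hb hb₁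
  have iτA := index_eq ⟨τ, hτA⟩ ha ha₂
  have iτB := index_eq ⟨τ, hτB⟩ hb hb₂
  -- Pulled back by `σ⁻¹`, the bases of `σ A` and `σ τ A` compute the index of `τ` a second time;
  -- this determines the length of `a₃`.
  have iτA' := index_eq ⟨τ, hτA⟩ ha₁.map_inv ha₃.map_inv
  have iτB' := index_eq ⟨τ, hτB⟩ hb₁.map_inv hb₃.map_inv
  have iσ := index_eq ⟨σ, hσ⟩ H₀ H₁
  have iτ := index_eq ⟨τ, hτ⟩ H₀ H₂
  simp only [List.length_map, List.length_append, Nat.cast_add] at iτA' iτB' iσ iτ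
  have jσ : index (A ⊔ B) ⟨σ, hσ⟩ = index A ⟨σ, hσA⟩ + index B ⟨σ, hσB⟩ := by omega
  have jτ : index (A ⊔ B) ⟨τ, hτ⟩ = index A ⟨τ, hτA⟩ + index B ⟨τ, hτB⟩ := by omega
  have k₁ : (a₁.length : ℤ) = a.length - index A ⟨σ, hσA⟩ := by omega
  have k₂ : (a₂.length : ℤ) = a.length - index A ⟨τ, hτA⟩ := by omega
  have k₃ : (a₃.length : ℤ) = a.length - index A ⟨σ, hσA⟩ - index A ⟨τ, hτA⟩ := by omega
  have l₁ : (b₁.length : ℤ) = b.length - index B ⟨σ, hσB⟩ := by omega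
  have l₂ : (b₂.length : ℤ) = b.length - index B ⟨τ, hτB⟩ := by omega
  rw [signedPairing, signedPairing, signedPairing, jσ, jτ, mul_mul_mul_comm, ← zpow_add]
  rw [← zpow_natCast, ← zpow_natCast, ← zpow_natCast, ← zpow_natCast, ← zpow_add, ← zpow_add]
    at c''
  refine units_eq_of_signs (n := _) c'' ?_
  push_cast
  rw [k₁, k₂, k₃, l₁, l₂]
  generalize index A ⟨σ, hσA⟩ = p
  generalize index A ⟨τ, hτA⟩ = q
  generalize index B ⟨σ, hσB⟩ = p'
  generalize index B ⟨τ, hτB⟩ = q'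
  generalize (a.length : ℤ) = a
  generalize (b.length : ℤ) = b
  -- The witness is half of the total exponent. Modulo 2 the four tensor signs add up to `p q' + p'
  -- q`, the cross terms of `(p + p') (q + q')`.
  exact ⟨p * q' + p' * q + 4 * a * b - 2 * b * p - 2 * b * q - a * p' - a * q' + p * p' + q * q',
    by ring⟩

/-! ### Finite-dimensional corrections and almost direct sums -/

theorem exists_disjoint_sup_eq {N A : Submodule k V} (h : N ≤ A) :
    ∃ C : Submodule k V, Disjoint N C ∧ N ⊔ C = A := by
  obtain ⟨Q, hQ⟩ := Submodule.exists_isCompl N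
  refine ⟨Q ⊓ A, hQ.disjoint.mono_right inf_le_left, ?_⟩
  rw [← sup_inf_assoc_of_le Q h, hQ.sup_eq_top, top_inf_eq]

theorem AlmostLE.bot_of_disjoint {N C A : Submodule k V} (h : AlmostLE A N) (hd : Disjoint N C)
    (hC : C ≤ A) : AlmostLE C ⊥ := by
  have := ((AlmostLE.of_le hC).trans h).exists_le
  rwa [hd.eq_bot] at this

theorem AlmostLE.mem_glRel {A : Submodule k V} (h : AlmostLE A ⊥) (f : V ≃ₗ[k] V) :
    f ∈ glRel A := by
  have hf := h.map (f : V →ₗ[k] V)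
  rw [Submodule.map_bot] at hf
  exact commensurable_iff.2 ⟨hf.trans (.of_le bot_le), h.trans (.of_le bot_le)⟩

/-- The zero subspace is fixed by every automorphism. -/
theorem signedPairing_eq_one_of_almostLE_bot {A : Submodule k V} (hA : AlmostLE A ⊥)
    {σ τ : V ≃ₗ[k] V} (hσ : σ ∈ glRel A) (hτ : τ ∈ glRel A) (h : Commute σ τ) :
    signedPairing A hσ hτ h = 1 :=
  signedPairing_eq_one_of_fixed bot_le hA (Submodule.map_bot _) (Submodule.map_bot _) hσ hτ h

theorem commensurable_of_le {N A : Submodule k V} (hNA : N ≤ A) (hA : AlmostLE A N) :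
    Commensurable A N :=
  commensurable_iff.2 ⟨hA, .of_le hNA⟩

/-- Invariance of the signed pairing under finite-dimensional enlargement. -/
theorem signedPairing_eq_of_le {N A : Submodule k V} (hNA : N ≤ A) (hA : AlmostLE A N)
    {σ τ : V ≃ₗ[k] V} (hσN : σ ∈ glRel N) (hτN : τ ∈ glRel N) (hσ : σ ∈ glRel A)
    (hτ : τ ∈ glRel A) (h : Commute σ τ) :
    signedPairing A hσ hτ h = signedPairing N hσN hτN h := by
  -- A complement of `N` in `A` is finite dimensional, hence preserved up to commensurability by
  -- everything, and contributes the factor `1`.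
  obtain ⟨C, hd, rfl⟩ := exists_disjoint_sup_eq hNA
  have hC := hA.bot_of_disjoint hd le_sup_right
  rw [signedPairing_sup_of_disjoint hd hσN hτN (hC.mem_glRel σ) (hC.mem_glRel τ),
    signedPairing_eq_one_of_almostLE_bot hC, mul_one]

/-- Multiplicativity of the signed pairing in almost direct sums. -/
theorem signedPairing_sup {A B : Submodule k V} (hAB : AlmostLE (A ⊓ B) ⊥)
    {σ τ : V ≃ₗ[k] V} (hσA : σ ∈ glRel A) (hτA : τ ∈ glRel A) (hσB : σ ∈ glRel B)
    (hτB : τ ∈ glRel B) (hσ : σ ∈ glRel (A ⊔ B)) (hτ : τ ∈ glRel (A ⊔ B)) (h : Commute σ τ) :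
    signedPairing (A ⊔ B) hσ hτ h = signedPairing A hσA hτA h * signedPairing B hσB hτB h := by
  -- Replacing `B` by a complement `C` of `A ∩ B` in `B` makes the sum direct. It changes neither `A
  -- + B` nor the pairing of `B`, since `B / C` is finite dimensional.
  obtain ⟨C, hd, hC⟩ := exists_disjoint_sup_eq (inf_le_right : A ⊓ B ≤ B)
  have hCB : C ≤ B := hC ▸ le_sup_right
  have hBC : AlmostLE B C := by
    conv_lhs => rw [← hC]
    exact (hAB.trans (.of_le bot_le)).sup (.of_le le_rfl)
  have hAC : Disjoint A C := by
    rw [disjoint_iff_inf_le] at hd ⊢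
    exact (le_inf (le_inf inf_le_left (inf_le_right.trans hCB)) inf_le_right).trans hd
  have hsup : A ⊔ C = A ⊔ B := by
    rw [← hC, ← sup_assoc, sup_inf_self]
  have hσC := mem_glRel_of_commensurable (commensurable_of_le hCB hBC) hσB
  have hτC := mem_glRel_of_commensurable (commensurable_of_le hCB hBC) hτB
  rw [signedPairing_congr hsup.symm hσ hτ (hsup ▸ hσ) (hsup ▸ hτ),
    signedPairing_sup_of_disjoint hAC hσA hτA hσC hτC,
    signedPairing_eq_of_le hCB hBC hσC hτC hσB hτB]

theorem almostLE_bot_of_commensurable {A : Submodule k V} (h : Commensurable A ⊥) :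
    AlmostLE A ⊥ := (commensurable_iff.1 h).1

/-! ### From partial sums to the reciprocity law -/

/-- The signed pairing of a partial sum of the family. -/
theorem signedPairing_iSup (W : I → Submodule k V)
    (hW : ∀ i, AlmostLE (W i ⊓ ⨆ (j : I) (_ : j ≠ i), W j) ⊥) {σ τ : V ≃ₗ[k] V}
    (hσ : ∀ i, σ ∈ glRel (W i)) (hτ : ∀ i, τ ∈ glRel (W i)) (h : Commute σ τ) (F S : Finset I)
    (hσF : ∀ i ∉ F, (W i).map (σ : V →ₗ[k] V) = W i)
    (hτF : ∀ i ∉ F, (W i).map (τ : V →ₗ[k] V) = W i) (hS : S ⊆ F) :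
    ∃ (hσS : σ ∈ glRel (⨆ (i : I) (_ : i ∉ F ∨ i ∈ S), W i))
      (hτS : τ ∈ glRel (⨆ (i : I) (_ : i ∉ F ∨ i ∈ S), W i)),
      signedPairing _ hσS hτS h = ∏ i ∈ S, signedPairing (W i) (hσ i) (hτ i) h := by
  classical
  induction S using Finset.induction_on with
  | empty =>
    -- The induction starts from the sum of all members outside `F`, possibly infinitely many, which
    -- is fixed because each of them is.
    have fixed : ∀ f : V ≃ₗ[k] V, (∀ i ∉ F, (W i).map (f : V →ₗ[k] V) = W i) →
        (⨆ (i : I) (_ : i ∉ F ∨ i ∈ (∅ : Finset I)), W i).map (f : V →ₗ[k] V) =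
          ⨆ (i : I) (_ : i ∉ F ∨ i ∈ (∅ : Finset I)), W i := by
      intro f hf
      simp only [Submodule.map_iSup]
      refine iSup_congr fun i => iSup_congr fun hi => hf i ?_
      simpa using hi
    have mem : ∀ (A : Submodule k V) (f : V ≃ₗ[k] V), A.map (f : V →ₗ[k] V) = A →
        f ∈ glRel A := by
      intro A f hf
      rw [mem_glRel_iff, hf]
      exact .refl A
    refine ⟨mem _ _ (fixed σ hσF), mem _ _ (fixed τ hτF), ?_⟩
    rw [Finset.prod_empty]
    exact signedPairing_eq_one_of_fixed le_rfl (.of_le le_rfl) (fixed σ hσF) (fixed τ hτF) _ _ h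
  | insert j S hj ih =>
    obtain ⟨h1, h2, h3⟩ := ih ((Finset.subset_insert j S).trans hS)
    have hjF : j ∈ F := hS (Finset.mem_insert_self j S)
    have hsup : (⨆ (i : I) (_ : i ∉ F ∨ i ∈ insert j S), W i) =
        (⨆ (i : I) (_ : i ∉ F ∨ i ∈ S), W i) ⊔ W j := by
      apply le_antisymm
      · refine iSup₂_le fun i hi => ?_
        rw [Finset.mem_insert] at hi
        rcases hi with hi | rfl | hi
        · exact le_sup_of_le_left (le_iSup₂_of_le i (.inl hi) le_rfl)
        · exact le_sup_right
        · exact le_sup_of_le_left (le_iSup₂_of_le i (.inr hi) le_rfl)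
      · refine sup_le (iSup₂_le fun i hi => ?_) ?_
        · exact le_iSup₂_of_le i (hi.imp_right (Finset.mem_insert_of_mem)) le_rfl
        · exact le_iSup₂_of_le j (.inr (Finset.mem_insert_self j S)) le_rfl
    -- As `j ∈ F` and `j ∉ S`, the partial sum involves only indices different from `j`, and
    -- admissibility at `j` applies.
    have hfin : AlmostLE ((⨆ (i : I) (_ : i ∉ F ∨ i ∈ S), W i) ⊓ W j) ⊥ := by
      refine (AlmostLE.of_le ?_).trans (hW j)
      refine le_inf inf_le_right (inf_le_left.trans (iSup₂_le fun i hi => ?_))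
      refine le_iSup₂_of_le i ?_ le_rfl
      rintro rfl
      exact hi.elim (fun hi => hi hjF) hj
    have h4 := mem_glRel_sup h1 (hσ j)
    have h5 := mem_glRel_sup h2 (hτ j)
    refine ⟨hsup ▸ h4, hsup ▸ h5, ?_⟩
    rw [signedPairing_congr hsup _ _ h4 h5, signedPairing_sup hfin h1 h2 (hσ j) (hτ j), h3,
      Finset.prod_insert hj, mul_comm]

end Reciprocity

end ACK

theorem mainTheorem4 {k V I : Type*} [Field k] [AddCommGroup V] [Module k V]
    (W : I → Submodule k V) (hW : ACK.ReciprocityAdmissible W)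
    (σ τ : ACK.restrictedGL W) (hστ : Commute σ τ) :
    {i : I |
      (-1 : kˣ) ^ (ACK.index (W i) (ACK.restrictedGL.toGL W i σ) *
          ACK.index (W i) (ACK.restrictedGL.toGL W i τ)) *
        ACK.commutatorPairing (W i) (hστ.map (ACK.restrictedGL.toGL W i)) ≠ 1}.Finite ∧
    ∏ᶠ i : I, (
      (-1 : kˣ) ^ (ACK.index (W i) (ACK.restrictedGL.toGL W i σ) *
          ACK.index (W i) (ACK.restrictedGL.toGL W i τ)) *
        ACK.commutatorPairing (W i) (hστ.map (ACK.restrictedGL.toGL W i))) = 1 := by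
  classical
  have h : Commute (σ : V ≃ₗ[k] V) (τ : V ≃ₗ[k] V) := congrArg Subtype.val hστ
  change {i : I | ACK.signedPairing (W i) (σ.2.1 i) (τ.2.1 i) h ≠ 1}.Finite ∧
    ∏ᶠ i : I, ACK.signedPairing (W i) (σ.2.1 i) (τ.2.1 i) h = 1
  -- The indices at which `σ` or `τ` moves the subspace; every other factor is `1`.
  let F : Finset I := (σ.2.2.union τ.2.2).toFinset
  have hF : ∀ i ∉ F, (W i).map ((σ : V ≃ₗ[k] V) : V →ₗ[k] V) = W i ∧
      (W i).map ((τ : V ≃ₗ[k] V) : V →ₗ[k] V) = W i := by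
    intro i hi
    simpa [F] using hi
  have hsub : {i : I | ACK.signedPairing (W i) (σ.2.1 i) (τ.2.1 i) h ≠ 1} ⊆ F := by
    intro i hi
    by_contra hiF
    exact hi (ACK.signedPairing_eq_one_of_fixed le_rfl (.of_le le_rfl) (hF i hiF).1 (hF i hiF).2
      _ _ h)
  refine ⟨F.finite_toSet.subset hsub, ?_⟩
  rw [finprod_eq_prod_of_mulSupport_subset _ hsub]
  obtain ⟨hσF, hτF, hprod⟩ := ACK.signedPairing_iSup W
    (fun i => ACK.almostLE_bot_of_commensurable (hW.2 i)) σ.2.1 τ.2.1 h F F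
    (fun i hi => (hF i hi).1) (fun i hi => (hF i hi).2) subset_rfl
  have htop : (⨆ (i : I) (_ : i ∉ F ∨ i ∈ F), W i) = ⨆ i, W i :=
    iSup_congr fun i => iSup_pos (em' (i ∈ F))
  have hfix : ∀ f : V ≃ₗ[k] V, (⊤ : Submodule k V).map (f : V →ₗ[k] V) = ⊤ := fun f => by
    rw [Submodule.map_top, LinearMap.range_eq_top]
    exact f.surjective
  have hmem : ∀ f : V ≃ₗ[k] V, f ∈ ACK.glRel (⊤ : Submodule k V) := fun f => by
    rw [ACK.mem_glRel_iff, hfix]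
    exact .refl ⊤
  -- With `S = F` the partial sum is the sum of the whole family. It has finite codimension in `V`,
  -- so its pairing is that of `V`, which all automorphisms fix.
  rw [← hprod, ← ACK.signedPairing_eq_of_le le_top
    (htop ▸ (ACK.commensurable_iff.1 hW.1).2) hσF hτF (hmem σ) (hmem τ) h]
  exact ACK.signedPairing_eq_one_of_fixed le_rfl (.of_le le_rfl) (hfix σ) (hfix τ) _ _ h
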